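/- Let $a,b,c,\sigma$ be measurable functions on $[0,\infty)$ with values in the real matrices of sizes $d_1\times d_1$, $d_1\times m_1$, $d_2\times d_1$, $d_2\times m_2$, such that for every $t\ge 0$ $$\int_0^t|a(s)|\,ds<\infty,\quad \int_0^t|b(s)|^2ds<\infty,\quad \int_0^t|c(s)|^2ds<\infty,\quad \int_0^t|\sigma(s)|^2ds<\infty$$ ($|\cdot|$ the Frobenius norm), and such that for some constant $C>0$ the smallest eigenvalue of $\sigma(t)\sigma(t)^\top$ exceeds $C$ for all $t\ge0$. Let $X_0$ be an $\mathbb R^{d_1}$-valued (possibly degenerate) Gaussian random vector with covariance matrix $V[X_0]$, and write $R(t)=c(t)^\top(\sigma(t)\sigma(t)^\top)^{-1}c(t)$. All differential equations below are understood in integrated form (absolutely continuous solutions). For each $t\ge0$ let $\phi(\cdot\,;t)$ be the symmetric negative semidefinite solution on $[0,t]$ of $$\frac{d\phi}{ds}(s;t)=-\phi(s;t)b(s)b(s)^\top\phi(s;t)-a(s)^\top\phi(s;t)-\phi(s;t)a(s)+R(s),\qquad \phi(t;t)=0,$$ and let $\gamma$ be the positive semidefinite solution on $[0,\infty)$ of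 $$\frac{d\gamma}{dt}(t)=-\gamma(t)R(t)\gamma(t)+a(t)\gamma(t)+\gamma(t)a(t)^\top+b(t)b(t)^\top,\qquad \gamma(0)=V[X_0].$$ Let $\tilde V$ be an $m_1$-dimensional standard Brownian motion. For each $t\ge0$ let $\{\xi_{s;t}\}_{0\le s\le t}$ be a continuous solution of $$d_s\xi_{s;t}=\{a(s)+b(s)b(s)^\top\phi(s;t)\}\,\xi_{s;t}\,ds+b(s)\,d\tilde V_s,$$ where $\xi_{0;t}$ is Gaussian with mean $0$, independent of $\tilde V$, with covariance matrix $$V[\xi_{0;t}]=V[X_0]^{1/2}\bigl(I-V[X_0]^{1/2}\phi(0;t)V[X_0]^{1/2}\bigr)^{-1}V[X_0]^{1/2}.$$ Then $\xi_{s;t}$ is square integrable for all $0\le s\le t$, and for every $s\ge0$ the cross-covariance matrix $t\mapsto\mathrm{Cov}(\xi_{t;t},\xi_{s;t})$, $t\ge s$, satisfies $$d_t\,\mathrm{Cov}(\xi_{t;t},\xi_{s;t})=\{a(t)-\gamma(t)c(t)^\top(\sigma(t)\sigma(t)^\top)^{-1}c(t)\}\,\mathrm{Cov}(\xi_{t;t},\xi_{s;t})\,dt,$$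 that is, the right-hand side is locally integrable in $t\in[s,\infty)$ and the cross-covariance is an integral of it. Equivalently, together with its initial value $\gamma(s)$ at $t=s$, $$\mathrm{Cov}(\xi_{t;t},\xi_{s;t})=\Phi(t,s)\,\gamma(s)\qquad(0\le s\le t),$$ where $\Phi$ is the transition matrix of the filter dynamics, which exists: $d_t\Phi(t,s)=\{a(t)-\gamma(t)R(t)\}\Phi(t,s)\,dt$ for $t\ge s$, $\Phi(s,s)=I$. -/

import Mathlib

open MeasureTheory ProbabilityTheory Filter Topology Set
open scoped NNReal ENNReal Matrix

noncomputable section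

namespace LinearFilter

/-- The Frobenius norm of a real matrix. -/
def frob {p q : ℕ} (A : Matrix (Fin p) (Fin q) ℝ) : ℝ :=
  Real.sqrt (∑ i, ∑ j, A i j ^ 2)

/-- The standing assumptions on the (measurable) coefficients of the linear system
`dX = a X dt + b dV`, `dY = c X dt + σ dW`: `a` is locally integrable, `b`, `c`, `σ` are locally
square integrable on `[0, ∞)`, and the smallest eigenvalue of `σ σᵀ` is bounded below by a
positive constant, uniformly in time. -/
structure Admissible {d₁ d₂ m₁ m₂ : ℕ}
    (a : ℝ → Matrix (Fin d₁) (Fin d₁) ℝ) (b : ℝ → Matrix (Fin d₁) (Fin m₁) ℝ)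
    (c : ℝ → Matrix (Fin d₂) (Fin d₁) ℝ) (σ : ℝ → Matrix (Fin d₂) (Fin m₂) ℝ) : Prop where
  meas_a : ∀ i j, Measurable fun t => a t i j
  meas_b : ∀ i j, Measurable fun t => b t i j
  meas_c : ∀ i j, Measurable fun t => c t i j
  meas_σ : ∀ i j, Measurable fun t => σ t i j
  int_a : ∀ t, 0 ≤ t → IntegrableOn (fun s => frob (a s)) (Icc 0 t)
  int_b : ∀ t, 0 ≤ t → IntegrableOn (fun s => frob (b s) ^ 2) (Icc 0 t)
  int_c : ∀ t, 0 ≤ t → IntegrableOn (fun s => frob (c s) ^ 2) (Icc 0 t)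
  int_σ : ∀ t, 0 ≤ t → IntegrableOn (fun s => frob (σ s) ^ 2) (Icc 0 t)
  elliptic : ∃ C : ℝ, 0 < C ∧ ∀ t, 0 ≤ t → ∀ μ ∈ spectrum ℝ (σ t * (σ t)ᵀ), C < μ

/-- `dM = f dt` on `[u, v]`, in the sense of absolutely continuous matrix functions: the entries
of `f` are integrable on `[u, v]` and `M s = M u + ∫_u^s f` for all `s ∈ [u, v]`. -/
def HasIntegralDerivOn {p q : ℕ} (M f : ℝ → Matrix (Fin p) (Fin q) ℝ) (u v : ℝ) : Prop :=
  ∀ i j, IntervalIntegrable (fun r => f r i j) volume u v ∧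
    ∀ s ∈ Icc u v, M s i j = M u i j + ∫ r in u..s, f r i j

/-- The matrix `cᵀ (σ σᵀ)⁻¹ c`. -/
def obs {d₁ d₂ m₂ : ℕ} (c : ℝ → Matrix (Fin d₂) (Fin d₁) ℝ)
    (σ : ℝ → Matrix (Fin d₂) (Fin m₂) ℝ) (t : ℝ) : Matrix (Fin d₁) (Fin d₁) ℝ :=
  (c t)ᵀ * (σ t * (σ t)ᵀ)⁻¹ * c t

/-- `φ t s` is the negative semidefinite symmetric solution `φ(s; t)`, `0 ≤ s ≤ t`, of
`dφ/ds = - φ b bᵀ φ - aᵀ φ - φ a + cᵀ (σ σᵀ)⁻¹ c` with `φ(t; t) = 0`. -/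
structure IsBackwardRiccati {d₁ d₂ m₁ m₂ : ℕ}
    (a : ℝ → Matrix (Fin d₁) (Fin d₁) ℝ) (b : ℝ → Matrix (Fin d₁) (Fin m₁) ℝ)
    (c : ℝ → Matrix (Fin d₂) (Fin d₁) ℝ) (σ : ℝ → Matrix (Fin d₂) (Fin m₂) ℝ)
    (φ : ℝ → ℝ → Matrix (Fin d₁) (Fin d₁) ℝ) : Prop where
  terminal : ∀ t, 0 ≤ t → φ t t = 0
  negSemidef : ∀ t, 0 ≤ t → ∀ s ∈ Icc 0 t, (-(φ t s)).PosSemidef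
  eqn : ∀ t, 0 ≤ t → HasIntegralDerivOn (φ t)
    (fun s => -(φ t s * (b s * (b s)ᵀ) * φ t s) - (a s)ᵀ * φ t s - φ t s * a s + obs c σ s) 0 t

/-- `γ` is the positive semidefinite solution on `[0, ∞)` of
`dγ/dt = - γ cᵀ (σ σᵀ)⁻¹ c γ + a γ + γ aᵀ + b bᵀ` with `γ(0) = Γ₀`. -/
structure IsForwardRiccati {d₁ d₂ m₁ m₂ : ℕ}
    (a : ℝ → Matrix (Fin d₁) (Fin d₁) ℝ) (b : ℝ → Matrix (Fin d₁) (Fin m₁) ℝ)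
    (c : ℝ → Matrix (Fin d₂) (Fin d₁) ℝ) (σ : ℝ → Matrix (Fin d₂) (Fin m₂) ℝ)
    (Γ₀ : Matrix (Fin d₁) (Fin d₁) ℝ) (γ : ℝ → Matrix (Fin d₁) (Fin d₁) ℝ) : Prop where
  initial : γ 0 = Γ₀
  posSemidef : ∀ t, 0 ≤ t → (γ t).PosSemidef
  eqn : ∀ T, 0 ≤ T → HasIntegralDerivOn γ
    (fun t => -(γ t * obs c σ t * γ t) + a t * γ t + γ t * (a t)ᵀ + b t * (b t)ᵀ) 0 T

section Sqrt

open scoped MatrixOrder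

/-- The positive semidefinite square root of a positive semidefinite matrix. -/
def matSqrt {d : ℕ} (A : Matrix (Fin d) (Fin d) ℝ) : Matrix (Fin d) (Fin d) ℝ := CFC.sqrt A

end Sqrt

/-- `Γ^{1/2} (I - Γ^{1/2} φ Γ^{1/2})⁻¹ Γ^{1/2}`. -/
def initialCov {d : ℕ} (Γ φ : Matrix (Fin d) (Fin d) ℝ) : Matrix (Fin d) (Fin d) ℝ :=
  matSqrt Γ * (1 - matSqrt Γ * φ * matSqrt Γ)⁻¹ * matSqrt Γ

section Probability

variable {Ω : Type*} [MeasurableSpace Ω]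

/-- The cross-covariance matrix `Cov(X, Y) = E[(X - E X)(Y - E Y)ᵀ]` of two random vectors. -/
def crossCov {p q : ℕ} (X : Ω → Fin p → ℝ) (Y : Ω → Fin q → ℝ) (P : Measure Ω) :
    Matrix (Fin p) (Fin q) ℝ :=
  Matrix.of fun i j => cov[fun ω => X ω i, fun ω => Y ω j; P]

/-- An `m`-dimensional standard Brownian motion: independent real Brownian components. -/
structure IsBrownianVec {m : ℕ} (B : Fin m → ℝ≥0 → Ω → ℝ) (P : Measure Ω) : Prop where
  brownian : ∀ j, IsBrownianReal (B j) P
  indep : iIndepFun (fun j ω r => B j r ω) P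

/-- Data of a deterministic left-continuous matrix-valued step function
`∑_{k < n} A_k 1_{(τ_k, τ_{k+1}]}`. -/
structure StepFun (p m : ℕ) where
  n : ℕ
  τ : ℕ → ℝ≥0
  mono : Monotone τ
  A : ℕ → Matrix (Fin p) (Fin m) ℝ

/-- The value of a step function. -/
def StepFun.eval {p m : ℕ} (g : StepFun p m) (r : ℝ) : Matrix (Fin p) (Fin m) ℝ :=
  ∑ k ∈ Finset.range g.n, (Ioc (g.τ k : ℝ) (g.τ (k + 1))).indicator (fun _ => g.A k) r

/-- The elementary stochastic integral `∫_0^s g dB = ∑_k A_k (B_{τ_{k+1} ∧ s} - B_{τ_k ∧ s})`. -/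
def StepFun.integral {p m : ℕ} (g : StepFun p m) (B : Fin m → ℝ≥0 → Ω → ℝ) (s : ℝ≥0) (ω : Ω) :
    Fin p → ℝ :=
  ∑ k ∈ Finset.range g.n, g.A k *ᵥ fun j => B j (min (g.τ (k + 1)) s) ω - B j (min (g.τ k) s) ω

/-- `I = ∫_0^s f dB` (Wiener integral of the deterministic function `f`, for `s ≥ 0`): `I` is the
`L²(P)`-limit of the elementary integrals of some sequence of step functions that converges to `f`
in `L²([0, s])`. By the Itô isometry this determines `I` almost surely. -/
def IsWienerIntegral {p m : ℕ} (B : Fin m → ℝ≥0 → Ω → ℝ) (P : Measure Ω)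
    (f : ℝ → Matrix (Fin p) (Fin m) ℝ) (s : ℝ) (I : Ω → Fin p → ℝ) : Prop :=
  ∃ g : ℕ → StepFun p m,
    Tendsto (fun n => ∫⁻ r in Icc 0 s, ENNReal.ofReal (frob ((g n).eval r - f r) ^ 2)) atTop (𝓝 0) ∧
    Tendsto (fun n => eLpNorm (fun ω => (g n).integral B s.toNNReal ω - I ω) 2 P) atTop (𝓝 0)

/-- `ξ` is a continuous solution on `[0, t]` of the linear equation
`dξ_s = A(s) ξ_s ds + b(s) dB_s`. -/
structure IsLinearSDESolution {d m : ℕ} (B : Fin m → ℝ≥0 → Ω → ℝ) (P : Measure Ω)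
    (A : ℝ → Matrix (Fin d) (Fin d) ℝ) (b : ℝ → Matrix (Fin d) (Fin m) ℝ) (t : ℝ)
    (ξ : ℝ → Ω → Fin d → ℝ) : Prop where
  aemeasurable : ∀ s ∈ Icc 0 t, AEMeasurable (ξ s) P
  continuousOn : ∀ᵐ ω ∂P, ContinuousOn (fun s => ξ s ω) (Icc 0 t)
  eqn : ∀ s ∈ Icc 0 t,
    IsWienerIntegral B P b s (fun ω => ξ s ω - ξ 0 ω - ∫ r in (0 : ℝ)..s, A r *ᵥ ξ r ω)

/-- The family `ξ t s = ξ_{s;t}`, `0 ≤ s ≤ t`: for each `t ≥ 0` it solves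
`d_s ξ_{s;t} = {a(s) + b(s) b(s)ᵀ φ(s;t)} ξ_{s;t} ds + b(s) dB_s`, where `ξ_{0;t}` is centred
Gaussian, independent of `B`, with covariance matrix `Γ^{1/2}(I - Γ^{1/2} φ(0;t) Γ^{1/2})⁻¹Γ^{1/2}`,
`Γ = V[X₀]`. -/
structure IsSmoothingFamily {d m : ℕ} (B : Fin m → ℝ≥0 → Ω → ℝ) (P : Measure Ω)
    (a : ℝ → Matrix (Fin d) (Fin d) ℝ) (b : ℝ → Matrix (Fin d) (Fin m) ℝ)
    (φ : ℝ → ℝ → Matrix (Fin d) (Fin d) ℝ) (X₀ : Ω → Fin d → ℝ)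
    (ξ : ℝ → ℝ → Ω → Fin d → ℝ) : Prop where
  gaussian : ∀ t, 0 ≤ t → HasGaussianLaw (ξ t 0) P
  mean_zero : ∀ t, 0 ≤ t → ∫ ω, ξ t 0 ω ∂P = 0
  cov_zero : ∀ t, 0 ≤ t → crossCov (ξ t 0) (ξ t 0) P = initialCov (crossCov X₀ X₀ P) (φ t 0)
  indep : ∀ t, 0 ≤ t → IndepFun (ξ t 0) (fun ω (j : Fin m) (r : ℝ≥0) => B j r ω) P
  sde : ∀ t, 0 ≤ t →
    IsLinearSDESolution B P (fun s => a s + b s * (b s)ᵀ * φ t s) b t (ξ t)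

end Probability

/-- `Φ t s`, `0 ≤ s ≤ t`, is the transition matrix of `dx/dt = F(t) x`:
`d_t Φ(t, s) = F(t) Φ(t, s) dt` for `t ≥ s` and `Φ(s, s) = I`. -/
structure IsTransitionMatrix {d : ℕ} (F : ℝ → Matrix (Fin d) (Fin d) ℝ)
    (Φ : ℝ → ℝ → Matrix (Fin d) (Fin d) ℝ) : Prop where
  initial : ∀ s, 0 ≤ s → Φ s s = 1
  eqn : ∀ s, 0 ≤ s → ∀ T, s ≤ T →
    HasIntegralDerivOn (fun t => Φ t s) (fun t => F t * Φ t s) s T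

end LinearFilter

end

/-!
Fix the final time `t` and write `A = a + b bᵀ φ(·; t)` for the drift of the smoothing equation,
`F = a - γ R` for that of the filter, `R = cᵀ (σ σᵀ)⁻¹ c`. Let `Ψ`, `Φ` be the fundamental
solutions of `x' = A x` and `x' = F x`, normalized at time `0`, and `Θ = Ψ⁻¹`, `Λ = Φ⁻¹`.

*Probability.* Variation of constants gives `Θ s ξ_s = ξ_0 + ∫₀ˢ Θ b dB`, a process with
uncorrelated increments, so `Cov(ξ_s, ξ_u) = Ψ s G(min s u) (Ψ u)ᵀ` with
`G s = V[ξ_0] + ∫₀ˢ Θ b bᵀ Θᵀ` (`IsLinearSDESolution.crossCov_eq`). Besides the independence of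
`ξ_0` and `B`, the only stochastic input is the Itô isometry for `J = ∫ b dB`, which passes from
step functions to the `L²` limit (`IsWienerIntegral.covariance_eq`); the integral `∫ Θ dJ` is a
pathwise one after integration by parts, and Fubini's theorem turns covariances of `J` into
covariances of `∫ Θ dJ` (`crossCov_integralByParts`).

*Algebra.* The matrix `N = 1 - γ φ` intertwines the two dynamics: the two Riccati equations give
`N' = F N - N A` (`hasIntegralDerivOn_one_sub_mul`). Hence `Λ N Ψ` is constant, and as
`φ(t; t) = 0` this yields `Ψ t = Φ t N 0`. Moreover `Λ γ Θᵀ` and `N 0 G` have the same derivative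
and the same initial value, because the initial covariance is `(1 - Γ φ(0; t))⁻¹ Γ`. Therefore
`Cov(ξ_t, ξ_s) = Φ t N 0 G s (Ψ s)ᵀ = Φ t Λ s γ s` (`fundamental_solution_mul_eq`). Here `t`
enters through `Φ t` alone, which gives the differential equation and the formula with the
transition matrix.

All equations are in integrated form with merely integrable coefficients. The product rule comes
from integration by parts for absolutely continuous functions (`HasIntegralDerivOn.mul`), and
fundamental solutions from a contraction in a weighted sup norm
(`exists_solution_linear_of_eq_zero`).
-/

namespace LinearFilter

/-! ### Calculus of absolutely continuous matrix functions -/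

theorem continuousOn_of_eq_add_integral {x f : ℝ → ℝ} {u v : ℝ} (huv : u ≤ v)
    (hf : IntervalIntegrable f volume u v)
    (hx : ∀ s ∈ Icc u v, x s = x u + ∫ r in u..s, f r) : ContinuousOn x (Icc u v) := by
  have h := intervalIntegral.continuousOn_primitive_interval' hf left_mem_uIcc
  rw [uIcc_of_le huv] at h
  exact (continuousOn_const.add h).congr hx

/-- The product rule for scalar absolutely continuous functions, in integrated form. -/
theorem mul_eq_add_integral {x f y g : ℝ → ℝ} {u v : ℝ} (huv : u ≤ v)
    (hf : IntervalIntegrable f volume u v) (hg : IntervalIntegrable g volume u v)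
    (hx : ∀ s ∈ Icc u v, x s = x u + ∫ r in u..s, f r)
    (hy : ∀ s ∈ Icc u v, y s = y u + ∫ r in u..s, g r) :
    IntervalIntegrable (fun r => f r * y r + x r * g r) volume u v ∧
      ∀ s ∈ Icc u v, x s * y s = x u * y u + ∫ r in u..s, (f r * y r + x r * g r) := by
  have cx := continuousOn_of_eq_add_integral huv hf hx
  have cy := continuousOn_of_eq_add_integral huv hg hy
  rw [← uIcc_of_le huv] at cx cy
  refine ⟨(hf.mul_continuousOn cy).add (hg.continuousOn_mul cx), fun s hs => ?_⟩
  have hsub : uIcc u s ⊆ uIcc u v := by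
    rw [uIcc_of_le huv, uIcc_of_le hs.1]; exact Icc_subset_Icc_right hs.2
  have hf' := hf.mono_set hsub
  have hg' := hg.mono_set hsub
  set X : ℝ → ℝ := fun z => x u + ∫ r in u..z, f r with hX
  set Y : ℝ → ℝ := fun z => y u + ∫ r in u..z, g r with hY
  have hac : ∀ (k : ℝ) {h : ℝ → ℝ}, IntervalIntegrable h volume u s →
      AbsolutelyContinuousOnInterval (fun z => k + ∫ r in u..z, h r) u s := fun k h hh =>
    ((LipschitzWith.const k).lipschitzOnWith.absolutelyContinuousOnInterval).add
      (hh.absolutelyContinuousOnInterval_intervalIntegral left_mem_uIcc)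
  have key := (hac (x u) hf').integral_deriv_mul_eq_sub (hac (y u) hg')
  have hXs : ∀ z ∈ uIcc u s, x z = X z := fun z hz => hx z (uIcc_of_le huv ▸ hsub hz)
  have hYs : ∀ z ∈ uIcc u s, y z = Y z := fun z hz => hy z (uIcc_of_le huv ▸ hsub hz)
  have hint : ∫ r in u..s, (f r * y r + x r * g r) =
      ∫ r in u..s, (deriv X r * Y r + X r * deriv Y r) := by
    apply intervalIntegral.integral_congr_ae
    filter_upwards [hf'.ae_hasDerivAt_integral, hg'.ae_hasDerivAt_integral] with z h1 h2 hz
    have hz' := uIoc_subset_uIcc hz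
    have d1 : HasDerivAt X (f z) z := (h1 hz' u left_mem_uIcc).const_add _
    have d2 : HasDerivAt Y (g z) z := (h2 hz' u left_mem_uIcc).const_add _
    rw [d1.deriv, d2.deriv, hXs z hz', hYs z hz']
  have e0 : X u = x u := by simp [hX]
  have e1 : Y u = y u := by simp [hY]
  rw [hint, hXs s right_mem_uIcc, hYs s right_mem_uIcc]
  have : ∫ r in u..s, (deriv X r * Y r + X r * deriv Y r) = X s * Y s - X u * Y u := key
  rw [this, e0, e1]; ring

section

variable {p q n : ℕ} {u v : ℝ}

theorem HasIntegralDerivOn.continuousOn {M f : ℝ → Matrix (Fin p) (Fin q) ℝ}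
    (h : HasIntegralDerivOn M f u v) (huv : u ≤ v) (i : Fin p) (j : Fin q) :
    ContinuousOn (fun r => M r i j) (Icc u v) :=
  continuousOn_of_eq_add_integral huv (h i j).1 (h i j).2

theorem HasIntegralDerivOn.mul {M f : ℝ → Matrix (Fin p) (Fin q) ℝ}
    {N g : ℝ → Matrix (Fin q) (Fin n) ℝ} (hM : HasIntegralDerivOn M f u v)
    (hN : HasIntegralDerivOn N g u v) (huv : u ≤ v) :
    HasIntegralDerivOn (fun r => M r * N r) (fun r => f r * N r + M r * g r) u v := by
  intro i j
  have h := fun k => mul_eq_add_integral huv (hM i k).1 (hN k j).1 (hM i k).2 (hN k j).2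
  have hI : IntervalIntegrable
      (fun r => ∑ k, (f r i k * N r k j + M r i k * g r k j)) volume u v := by
    have := IntervalIntegrable.sum Finset.univ (fun k _ => (h k).1)
    simpa only [Finset.sum_fn] using this
  have e : (fun r => (f r * N r + M r * g r) i j) =
      fun r => ∑ k, (f r i k * N r k j + M r i k * g r k j) := by
    ext r; simp [Matrix.mul_apply, Finset.sum_add_distrib]
  refine ⟨e ▸ hI, fun s hs => ?_⟩
  rw [e, intervalIntegral.integral_finsetSum]
  · simp only [Matrix.mul_apply, ← Finset.sum_add_distrib]
    exact Finset.sum_congr rfl fun k _ => (h k).2 s hs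
  · intro k _
    refine (h k).1.mono_set ?_
    rw [uIcc_of_le huv, uIcc_of_le hs.1]; exact Icc_subset_Icc_right hs.2

theorem HasIntegralDerivOn.add {M f N g : ℝ → Matrix (Fin p) (Fin q) ℝ}
    (hM : HasIntegralDerivOn M f u v) (hN : HasIntegralDerivOn N g u v) :
    HasIntegralDerivOn (fun r => M r + N r) (fun r => f r + g r) u v := by
  intro i j
  refine ⟨(hM i j).1.add (hN i j).1, fun s hs => ?_⟩
  have hsub : uIcc u s ⊆ uIcc u v := by
    rw [uIcc_of_le (hs.1.trans hs.2), uIcc_of_le hs.1]; exact Icc_subset_Icc_right hs.2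
  simp only [Matrix.add_apply]
  rw [intervalIntegral.integral_add ((hM i j).1.mono_set hsub) ((hN i j).1.mono_set hsub),
    (hM i j).2 s hs, (hN i j).2 s hs]
  ring

theorem HasIntegralDerivOn.neg {M f : ℝ → Matrix (Fin p) (Fin q) ℝ}
    (hM : HasIntegralDerivOn M f u v) :
    HasIntegralDerivOn (fun r => -M r) (fun r => -f r) u v := by
  intro i j
  refine ⟨(hM i j).1.neg, fun s hs => ?_⟩
  simp only [Matrix.neg_apply]
  rw [intervalIntegral.integral_neg, (hM i j).2 s hs]
  ring

theorem HasIntegralDerivOn.transpose {M f : ℝ → Matrix (Fin p) (Fin q) ℝ}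
    (hM : HasIntegralDerivOn M f u v) :
    HasIntegralDerivOn (fun r => (M r)ᵀ) (fun r => (f r)ᵀ) u v := fun i j => hM j i

theorem hasIntegralDerivOn_const (C : Matrix (Fin p) (Fin q) ℝ) :
    HasIntegralDerivOn (fun _ => C) (fun _ => 0) u v :=
  fun i j => ⟨by simp, fun s _ => by simp⟩

theorem HasIntegralDerivOn.congr {M N f g : ℝ → Matrix (Fin p) (Fin q) ℝ}
    (hM : HasIntegralDerivOn M f u v) (huv : u ≤ v) (h : ∀ s ∈ Icc u v, M s = N s)
    (h' : ∀ s ∈ Icc u v, f s = g s) : HasIntegralDerivOn N g u v := by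
  intro i j
  have hfg : EqOn (fun r => f r i j) (fun r => g r i j) (uIcc u v) := fun r hr => by
    simp only [h' r (uIcc_of_le huv ▸ hr)]
  refine ⟨(hM i j).1.congr (fun r hr => hfg (uIoc_subset_uIcc hr)), fun s hs => ?_⟩
  rw [← h s hs, ← h u (left_mem_Icc.2 huv), (hM i j).2 s hs]
  congr 1
  apply intervalIntegral.integral_congr
  intro r hr
  apply hfg
  rw [uIcc_of_le hs.1] at hr; rw [uIcc_of_le huv]
  exact Icc_subset_Icc_right hs.2 hr

theorem HasIntegralDerivOn.mono {M f : ℝ → Matrix (Fin p) (Fin q) ℝ} {u' v' : ℝ}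
    (hM : HasIntegralDerivOn M f u v) (hu : u ≤ u') (huv : u' ≤ v') (hv : v' ≤ v) :
    HasIntegralDerivOn M f u' v' := by
  intro i j
  have hmem : u' ∈ Icc u v := ⟨hu, huv.trans hv⟩
  have hsub : ∀ {s s'}, s ∈ Icc u v → s' ∈ Icc u v → uIcc s s' ⊆ uIcc u v := fun h h' =>
    uIcc_subset_uIcc (Icc_subset_uIcc h) (Icc_subset_uIcc h')
  refine ⟨(hM i j).1.mono_set (hsub hmem ⟨hu.trans huv, hv⟩), fun s hs => ?_⟩
  have hs' : s ∈ Icc u v := ⟨hu.trans hs.1, hs.2.trans hv⟩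
  have hl : u ∈ Icc u v := ⟨le_rfl, hmem.1.trans hmem.2⟩
  rw [(hM i j).2 s hs', (hM i j).2 u' hmem, ← intervalIntegral.integral_add_adjacent_intervals
    ((hM i j).1.mono_set (hsub hl hmem)) ((hM i j).1.mono_set (hsub hmem hs'))]
  ring

theorem HasIntegralDerivOn.const_mul {M f : ℝ → Matrix (Fin q) (Fin n) ℝ}
    (hM : HasIntegralDerivOn M f u v) (huv : u ≤ v) (C : Matrix (Fin p) (Fin q) ℝ) :
    HasIntegralDerivOn (fun r => C * M r) (fun r => C * f r) u v := by
  simpa using (hasIntegralDerivOn_const C).mul hM huv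

theorem HasIntegralDerivOn.mul_const {M f : ℝ → Matrix (Fin p) (Fin q) ℝ}
    (hM : HasIntegralDerivOn M f u v) (huv : u ≤ v) (C : Matrix (Fin q) (Fin n) ℝ) :
    HasIntegralDerivOn (fun r => M r * C) (fun r => f r * C) u v := by
  simpa using hM.mul (hasIntegralDerivOn_const C) huv

/-- Two functions with the same derivative and the same initial value agree. -/
theorem HasIntegralDerivOn.eq_of_eq {M N f : ℝ → Matrix (Fin p) (Fin q) ℝ}
    (hM : HasIntegralDerivOn M f u v) (hN : HasIntegralDerivOn N f u v) (h0 : M u = N u)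
    {s : ℝ} (hs : s ∈ Icc u v) : M s = N s := by
  ext i j; rw [(hM i j).2 s hs, (hN i j).2 s hs, h0]

end

/-! ### Fundamental solutions of linear equations with integrable coefficients -/

/-- `∫₀ˢ κ exp (2 ∫₀ κ) ≤ exp (2 ∫₀ˢ κ) / 2` for nonnegative locally integrable `κ`. The
exponential is monotone with almost everywhere derivative `2 κ exp (2 ∫₀ κ)`, and the integral of
the derivative of a monotone function is at most its increment. -/
theorem integral_mul_exp_primitive_le {κ : ℝ → ℝ} (h0 : ∀ r, 0 ≤ κ r)
    (hκ : ∀ a b, IntervalIntegrable κ volume a b) {s : ℝ} (hs : 0 ≤ s) :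
    ∫ r in (0 : ℝ)..s, κ r * Real.exp (2 * ∫ z in (0 : ℝ)..r, κ z) ≤
      Real.exp (2 * ∫ z in (0 : ℝ)..s, κ z) / 2 := by
  set E : ℝ → ℝ := fun r => Real.exp (2 * ∫ z in (0 : ℝ)..r, κ z) with hE
  have hmono : MonotoneOn E (uIcc 0 s) := by
    intro x _ y _ hxy
    have : (∫ z in (0 : ℝ)..x, κ z) + ∫ z in x..y, κ z = ∫ z in (0 : ℝ)..y, κ z :=
      intervalIntegral.integral_add_adjacent_intervals (hκ _ _) (hκ _ _)
    have h2 : 0 ≤ ∫ z in x..y, κ z := intervalIntegral.integral_nonneg hxy fun z _ => h0 z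
    exact Real.exp_le_exp.2 (by linarith)
  have h1 := hmono.intervalIntegral_deriv_mem_uIcc
  have hE0 : E 0 = 1 := by simp [hE]
  have hE1 : E 0 ≤ E s := hmono left_mem_uIcc right_mem_uIcc hs
  rw [uIcc_of_le (by linarith)] at h1
  have h3 : ∫ r in (0 : ℝ)..s, deriv E r = ∫ r in (0 : ℝ)..s, 2 * (κ r * E r) := by
    apply intervalIntegral.integral_congr_ae
    filter_upwards [(hκ 0 s).ae_hasDerivAt_integral] with z hz hzm
    have d := ((hz (uIoc_subset_uIcc hzm) 0 left_mem_uIcc).const_mul 2).exp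
    rw [d.deriv]; ring
  rw [h3, intervalIntegral.integral_const_mul] at h1
  have := h1.2
  linarith

/-- Existence for `x' = A x` with a locally integrable coefficient vanishing for negative times. In
the unknown `exp (-2 ∫ |A|) x` the integral operator is a `1/2`-contraction of the bounded
continuous functions on the whole line, so no gluing of local solutions is needed. -/
theorem exists_solution_linear_of_eq_zero {d : ℕ} (A : ℝ → Matrix (Fin d) (Fin d) ℝ)
    (hA : ∀ i j a b, IntervalIntegrable (fun r => A r i j) volume a b)
    (hA0 : ∀ r < 0, A r = 0) (x₀ : Fin d → ℝ) :
    ∃ x : ℝ → Fin d → ℝ, ∀ i,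
      (∀ T, 0 ≤ T → IntervalIntegrable (fun r => (A r *ᵥ x r) i) volume 0 T) ∧
      ∀ s, 0 ≤ s → x s i = x₀ i + ∫ r in (0 : ℝ)..s, (A r *ᵥ x r) i := by
  set κ : ℝ → ℝ := fun r => ∑ i, ∑ j, |A r i j| with hκdef
  have κ0 : ∀ r, 0 ≤ κ r := fun r => by positivity
  have hκ : ∀ a b, IntervalIntegrable κ volume a b := fun a b => by
    have := IntervalIntegrable.sum Finset.univ fun i _ =>
      IntervalIntegrable.sum Finset.univ fun j _ => (hA i j a b).abs
    simpa only [Finset.sum_fn] using this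
  have κz : ∀ r < 0, κ r = 0 := fun r hr => by simp [hκdef, hA0 r hr]
  set α : ℝ → ℝ := fun s => ∫ z in (0 : ℝ)..s, κ z with hα
  have αc : Continuous α := intervalIntegral.continuous_primitive hκ 0
  set w : ℝ → ℝ := fun s => Real.exp (2 * α s) with hw
  have wc : Continuous w := by fun_prop
  have wpos : ∀ s, 0 < w s := fun s => Real.exp_pos _
  have hint : ∀ (Y : ℝ → Fin d → ℝ), Continuous Y → ∀ i a b,
      IntervalIntegrable (fun r => (A r *ᵥ (w r • Y r)) i) volume a b := by
    intro Y hY i a b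
    have := IntervalIntegrable.sum Finset.univ fun k (_ : k ∈ Finset.univ) =>
      (hA i k a b).mul_continuousOn (g := fun r => w r * Y r k) (by fun_prop)
    have h2 : (fun r => (A r *ᵥ (w r • Y r)) i) = fun r => ∑ k, A r i k * (w r * Y r k) := by
      ext r; simp [Matrix.mulVec, dotProduct]
    rw [h2]
    simpa only [Finset.sum_fn] using this
  -- in the weighted norm the integral operator has norm at most `1 / 2`
  have hbound : ∀ (Y : ℝ → Fin d → ℝ), Continuous Y → ∀ C, (∀ r, ‖Y r‖ ≤ C) → ∀ i s,
      |∫ r in (0 : ℝ)..s, (A r *ᵥ (w r • Y r)) i| ≤ C * (w s / 2) := by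
    intro Y hY C hC i s
    have hC0 : 0 ≤ C := (norm_nonneg _).trans (hC 0)
    have hpt : ∀ r, |(A r *ᵥ (w r • Y r)) i| ≤ C * (κ r * w r) := by
      intro r
      have : (A r *ᵥ (w r • Y r)) i = ∑ k, A r i k * (w r * Y r k) := by
        simp [Matrix.mulVec, dotProduct]
      rw [this]
      calc |∑ k, A r i k * (w r * Y r k)| ≤ ∑ k, |A r i k * (w r * Y r k)| :=
            Finset.abs_sum_le_sum_abs _ _
        _ ≤ ∑ k, |A r i k| * (w r * C) := by
            refine Finset.sum_le_sum fun k _ => ?_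
            rw [abs_mul, abs_mul, abs_of_pos (wpos r)]
            have := (norm_le_pi_norm (Y r) k).trans (hC r)
            rw [Real.norm_eq_abs] at this
            have := (wpos r).le
            gcongr
        _ = (∑ k, |A r i k|) * (w r * C) := by rw [Finset.sum_mul]
        _ ≤ κ r * (w r * C) := by
            have := (wpos r).le
            gcongr
            exact Finset.single_le_sum (f := fun i => ∑ k, |A r i k|)
              (fun i _ => by positivity) (Finset.mem_univ i)
        _ = C * (κ r * w r) := by ring
    rcases le_or_gt 0 s with hs | hs
    · calc |∫ r in (0 : ℝ)..s, (A r *ᵥ (w r • Y r)) i|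
          ≤ ∫ r in (0 : ℝ)..s, C * (κ r * w r) := by
            rw [← Real.norm_eq_abs]
            refine intervalIntegral.norm_integral_le_of_norm_le hs
              (Eventually.of_forall fun r _ => hpt r) ?_
            exact ((hκ 0 s).mul_continuousOn wc.continuousOn).const_mul C
        _ = C * ∫ r in (0 : ℝ)..s, κ r * w r := intervalIntegral.integral_const_mul _ _
        _ ≤ C * (w s / 2) := by
            gcongr
            exact integral_mul_exp_primitive_le κ0 hκ hs
    · have : ∫ r in (0 : ℝ)..s, (A r *ᵥ (w r • Y r)) i = ∫ r in (0 : ℝ)..s, (0 : ℝ) := by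
        apply intervalIntegral.integral_congr_ae
        have h0 : ∀ᵐ r : ℝ, r ≠ 0 := by simp [ae_iff, measure_singleton]
        filter_upwards [h0] with r hr hrs
        rw [uIoc_of_ge hs.le] at hrs
        simp [hA0 r (lt_of_le_of_ne hrs.2 hr)]
      rw [this]
      have := wpos s
      simp only [intervalIntegral.integral_zero, abs_zero]
      positivity
  have hTc : ∀ (Y : ℝ → Fin d → ℝ), Continuous Y → Continuous fun s => fun i =>
      (w s)⁻¹ * (x₀ i + ∫ r in (0 : ℝ)..s, (A r *ᵥ (w r • Y r)) i) := by
    intro Y hY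
    refine continuous_pi fun i => ?_
    have := intervalIntegral.continuous_primitive (hint Y hY i) 0
    exact (wc.inv₀ fun s => (wpos s).ne').mul (continuous_const.add this)
  have w1 : ∀ s, 1 ≤ w s := by
    intro s
    refine Real.one_le_exp (mul_nonneg two_pos.le ?_)
    rcases le_or_gt 0 s with hs | hs
    · exact intervalIntegral.integral_nonneg hs fun z _ => κ0 z
    · refine le_of_eq (Eq.symm ?_)
      rw [hα]
      have : ∫ r in (0 : ℝ)..s, κ r = ∫ r in (0 : ℝ)..s, (0 : ℝ) := by
        apply intervalIntegral.integral_congr_ae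
        have h0 : ∀ᵐ r : ℝ, r ≠ 0 := by simp [ae_iff, measure_singleton]
        filter_upwards [h0] with r hr hrs
        rw [uIoc_of_ge hs.le] at hrs
        exact κz r (lt_of_le_of_ne hrs.2 hr)
      simpa using this
  -- the integral operator maps bounded functions to bounded functions, since `1 ≤ w`
  have hTb : ∀ (Y : BoundedContinuousFunction ℝ (Fin d → ℝ)) s,
      ‖fun i => (w s)⁻¹ * (x₀ i + ∫ r in (0 : ℝ)..s, (A r *ᵥ (w r • Y r)) i)‖ ≤ ‖x₀‖ + ‖Y‖ := by
    intro Y s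
    refine (pi_norm_le_iff_of_nonneg (by positivity)).2 fun i => ?_
    have h1 := hbound Y Y.continuous ‖Y‖ Y.norm_coe_le_norm i s
    have h2 := norm_le_pi_norm x₀ i
    have hwp := wpos s
    rw [norm_mul, norm_inv, Real.norm_of_nonneg hwp.le, inv_mul_le_iff₀ hwp]
    rw [← Real.norm_eq_abs] at h1
    refine (norm_add_le _ _).trans ?_
    nlinarith [mul_nonneg (norm_nonneg x₀) (sub_nonneg.2 (w1 s)), mul_nonneg hwp.le (norm_nonneg Y)]
  let T : BoundedContinuousFunction ℝ (Fin d → ℝ) → BoundedContinuousFunction ℝ (Fin d → ℝ) :=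
    fun Y => BoundedContinuousFunction.ofNormedAddCommGroup _ (hTc Y Y.continuous) _ (hTb Y)
  have hT : ContractingWith (1 / 2) T := by
    refine ⟨by norm_num, LipschitzWith.of_dist_le_mul fun Y Z => ?_⟩
    rw [BoundedContinuousFunction.dist_le (by positivity)]
    intro s
    refine (dist_pi_le_iff (by positivity)).2 fun i => ?_
    have h1 := hbound (fun r => Y r - Z r) (by fun_prop) (dist Y Z)
      (fun r => by rw [← dist_eq_norm]; exact Y.dist_coe_le_dist r) i s
    have h2 : ∫ r in (0 : ℝ)..s, (A r *ᵥ (w r • (Y r - Z r))) i =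
        (∫ r in (0 : ℝ)..s, (A r *ᵥ (w r • Y r)) i) -
          ∫ r in (0 : ℝ)..s, (A r *ᵥ (w r • Z r)) i := by
      rw [← intervalIntegral.integral_sub (hint Y Y.continuous i _ _) (hint Z Z.continuous i _ _)]
      simp only [smul_sub, Matrix.mulVec_sub, Pi.sub_apply]
    rw [h2] at h1
    have hwp := wpos s
    have h3 : T Y s i - T Z s i = (w s)⁻¹ * ((∫ r in (0 : ℝ)..s, (A r *ᵥ (w r • Y r)) i) -
        ∫ r in (0 : ℝ)..s, (A r *ᵥ (w r • Z r)) i) := by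
      simp only [T, BoundedContinuousFunction.coe_ofNormedAddCommGroup]; ring
    rw [Real.dist_eq, h3, abs_mul, abs_inv, abs_of_pos hwp, inv_mul_le_iff₀ hwp]
    refine h1.trans (le_of_eq ?_)
    push_cast; ring
  obtain ⟨Y, hY⟩ : ∃ Y, T Y = Y := ⟨hT.fixedPoint, hT.fixedPoint_isFixedPt⟩
  refine ⟨fun s => w s • Y s, fun i => ⟨fun T _ => hint Y Y.continuous i 0 T, fun s _ => ?_⟩⟩
  have : Y s i = (w s)⁻¹ * (x₀ i + ∫ r in (0 : ℝ)..s, (A r *ᵥ (w r • Y r)) i) :=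
    congrFun (congrArg (fun Z : BoundedContinuousFunction ℝ (Fin d → ℝ) => Z s) hY.symm) i
  change w s * Y s i = x₀ i + ∫ r in (0 : ℝ)..s, (A r *ᵥ (w r • Y r)) i
  rw [this, mul_inv_cancel_left₀ (wpos s).ne']

theorem exists_fundamental_solution {d : ℕ} (A : ℝ → Matrix (Fin d) (Fin d) ℝ)
    (hA : ∀ i j T, 0 ≤ T → IntervalIntegrable (fun r => A r i j) volume 0 T) :
    ∃ Ψ : ℝ → Matrix (Fin d) (Fin d) ℝ, Ψ 0 = 1 ∧
      ∀ T, 0 ≤ T → HasIntegralDerivOn Ψ (fun s => A s * Ψ s) 0 T := by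
  -- negative times are irrelevant, so the coefficient may be cut off there
  set A' : ℝ → Matrix (Fin d) (Fin d) ℝ := (Ici 0).indicator A with hA'
  have hA'0 : ∀ r < 0, A' r = 0 := fun r hr => indicator_of_notMem (by simpa using hr) _
  have hA'1 : ∀ r, 0 ≤ r → A' r = A r := fun r hr => indicator_of_mem (by simpa using hr) _
  have hpos : ∀ i j T, 0 ≤ T → IntervalIntegrable (fun r => A' r i j) volume 0 T := by
    intro i j T hT
    refine (hA i j T hT).congr fun r hr => ?_
    rw [uIoc_of_le hT] at hr
    simp only [hA'1 r hr.1.le]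
  have hneg : ∀ i j T, T ≤ 0 → IntervalIntegrable (fun r => A' r i j) volume 0 T := by
    intro i j T hT
    refine (intervalIntegrable_const (c := (0 : ℝ))).congr_ae ?_
    rw [Filter.EventuallyEq, ae_restrict_iff' measurableSet_uIoc]
    have h0 : ∀ᵐ r : ℝ, r ≠ 0 := by simp [ae_iff, measure_singleton]
    filter_upwards [h0] with r hr hrs
    rw [uIoc_of_ge hT] at hrs
    simp [hA'0 r (lt_of_le_of_ne hrs.2 hr)]
  have hall : ∀ i j a b, IntervalIntegrable (fun r => A' r i j) volume a b := by
    intro i j a b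
    have : ∀ T, IntervalIntegrable (fun r => A' r i j) volume 0 T := fun T =>
      (le_total 0 T).elim (hpos i j T) (hneg i j T)
    exact (this a).symm.trans (this b)
  choose x hx using fun j => exists_solution_linear_of_eq_zero A' hall hA'0 (Pi.single j 1)
  refine ⟨fun s => Matrix.of fun i j => x j s i, ?_, fun T hT => ?_⟩
  · ext i j
    have := (hx j i).2 0 le_rfl
    simp only [intervalIntegral.integral_same, add_zero] at this
    simp [this, Matrix.one_apply, Pi.single_apply]
  · have h : HasIntegralDerivOn (fun s => Matrix.of fun i j => x j s i)
        (fun s => A' s * Matrix.of fun i j => x j s i) 0 T := by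
      intro i j
      refine ⟨(hx j i).1 T hT, fun s hs => ?_⟩
      have h0 := (hx j i).2 0 le_rfl
      have h1 := (hx j i).2 s hs.1
      simp only [intervalIntegral.integral_same, add_zero] at h0
      simp only [Matrix.of_apply, h0]
      rw [h1]
      rfl
    exact h.congr hT (fun _ _ => rfl) fun s hs => by rw [hA'1 s hs.1]

/-- The fundamental solution `Ψ` of `x' = A x` together with its inverse `Θ`, which solves the
adjoint equation `Θ' = -Θ A`. -/
theorem exists_fundamental_solution_inverse {d : ℕ} (A : ℝ → Matrix (Fin d) (Fin d) ℝ)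
    (hA : ∀ i j T, 0 ≤ T → IntervalIntegrable (fun r => A r i j) volume 0 T) :
    ∃ Ψ Θ : ℝ → Matrix (Fin d) (Fin d) ℝ, Ψ 0 = 1 ∧ Θ 0 = 1 ∧
      (∀ T, 0 ≤ T → HasIntegralDerivOn Ψ (fun s => A s * Ψ s) 0 T) ∧
      (∀ T, 0 ≤ T → HasIntegralDerivOn Θ (fun s => -(Θ s * A s)) 0 T) ∧
      (∀ s, 0 ≤ s → Θ s * Ψ s = 1) ∧ ∀ s, 0 ≤ s → Ψ s * Θ s = 1 := by
  obtain ⟨Ψ, hΨ0, hΨ⟩ := exists_fundamental_solution A hA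
  obtain ⟨Λ, hΛ0, hΛ⟩ := exists_fundamental_solution (fun s => -(A s)ᵀ)
    fun i j T hT => (hA j i T hT).neg
  have hΘ : ∀ T, 0 ≤ T → HasIntegralDerivOn (fun s => (Λ s)ᵀ) (fun s => -((Λ s)ᵀ * A s)) 0 T :=
    fun T hT => (hΛ T hT).transpose.congr hT (fun _ _ => rfl) fun s _ => by
      simp [Matrix.transpose_mul]
  have h1 : ∀ s, 0 ≤ s → (Λ s)ᵀ * Ψ s = 1 := by
    intro s hs
    have hc := ((hΘ s hs).mul (hΨ s hs) hs).congr (g := fun _ => 0) hs (fun _ _ => rfl)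
      fun r _ => by simp [Matrix.mul_assoc]
    exact hc.eq_of_eq (hasIntegralDerivOn_const 1) (by simp [hΨ0, hΛ0]) ⟨hs, le_rfl⟩
  exact ⟨Ψ, fun s => (Λ s)ᵀ, hΨ0, by simp [hΛ0], hΨ, hΘ, h1, fun s hs =>
    mul_eq_one_comm.1 (h1 s hs)⟩

/-! ### Integrability of the coefficients -/

section

variable {p q n : ℕ}

theorem abs_apply_le_frob (A : Matrix (Fin p) (Fin q) ℝ) (i : Fin p) (j : Fin q) :
    |A i j| ≤ frob A := by
  refine Real.abs_le_sqrt ?_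
  refine (Finset.single_le_sum (f := fun j => A i j ^ 2) (fun _ _ => sq_nonneg _)
    (Finset.mem_univ j)).trans ?_
  exact Finset.single_le_sum (f := fun i => ∑ j, A i j ^ 2)
    (fun _ _ => Finset.sum_nonneg fun _ _ => sq_nonneg _) (Finset.mem_univ i)

theorem intervalIntegrable_mul_of_continuousOn {f : ℝ → Matrix (Fin p) (Fin q) ℝ}
    {M : ℝ → Matrix (Fin q) (Fin n) ℝ} {u v : ℝ} (huv : u ≤ v)
    (hf : ∀ i j, IntervalIntegrable (fun r => f r i j) volume u v)
    (hM : ∀ i j, ContinuousOn (fun r => M r i j) (Icc u v)) (i : Fin p) (j : Fin n) :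
    IntervalIntegrable (fun r => (f r * M r) i j) volume u v := by
  have := IntervalIntegrable.sum Finset.univ fun k (_ : k ∈ Finset.univ) =>
    (hf i k).mul_continuousOn (uIcc_of_le huv ▸ hM k j)
  simpa only [Matrix.mul_apply, Finset.sum_fn] using this

theorem intervalIntegrable_continuousOn_mul {M : ℝ → Matrix (Fin p) (Fin q) ℝ}
    {f : ℝ → Matrix (Fin q) (Fin n) ℝ} {u v : ℝ} (huv : u ≤ v)
    (hM : ∀ i j, ContinuousOn (fun r => M r i j) (Icc u v))
    (hf : ∀ i j, IntervalIntegrable (fun r => f r i j) volume u v) (i : Fin p) (j : Fin n) :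
    IntervalIntegrable (fun r => (M r * f r) i j) volume u v := by
  have := IntervalIntegrable.sum Finset.univ fun k (_ : k ∈ Finset.univ) =>
    (hf k j).continuousOn_mul (uIcc_of_le huv ▸ hM i k)
  simpa only [Matrix.mul_apply, Finset.sum_fn] using this

/-- A function with integrable entries is the derivative of an absolutely continuous one. -/
theorem hasIntegralDerivOn_integral {f : ℝ → Matrix (Fin p) (Fin q) ℝ} {u v : ℝ}
    (hf : ∀ i j, IntervalIntegrable (fun r => f r i j) volume u v)
    (C : Matrix (Fin p) (Fin q) ℝ) :
    HasIntegralDerivOn (fun s => C + Matrix.of fun i j => ∫ r in u..s, f r i j) f u v :=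
  fun i j => ⟨hf i j, fun s _ => by simp⟩

end

variable {d₁ d₂ m₁ m₂ : ℕ}
  {a : ℝ → Matrix (Fin d₁) (Fin d₁) ℝ} {b : ℝ → Matrix (Fin d₁) (Fin m₁) ℝ}
  {c : ℝ → Matrix (Fin d₂) (Fin d₁) ℝ} {σ : ℝ → Matrix (Fin d₂) (Fin m₂) ℝ}

theorem Admissible.intervalIntegrable_a (h : Admissible a b c σ) {T : ℝ} (hT : 0 ≤ T) (i j) :
    IntervalIntegrable (fun r => a r i j) volume 0 T := by
  rw [intervalIntegrable_iff_integrableOn_Icc_of_le hT]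
  exact (h.int_a T hT).mono' (h.meas_a i j).aestronglyMeasurable
    (Eventually.of_forall fun r => abs_apply_le_frob _ i j)

theorem Admissible.memLp_b (h : Admissible a b c σ) {T : ℝ} (hT : 0 ≤ T) (i j) :
    MemLp (fun r => b r i j) 2 (volume.restrict (Icc 0 T)) := by
  rw [memLp_two_iff_integrable_sq (h.meas_b i j).aestronglyMeasurable]
  refine (h.int_b T hT).mono' ((h.meas_b i j).pow_const 2).aestronglyMeasurable
    (Eventually.of_forall fun r => ?_)
  rw [Real.norm_eq_abs, abs_pow]
  exact pow_le_pow_left₀ (abs_nonneg _) (abs_apply_le_frob _ i j) 2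

theorem Admissible.intervalIntegrable_bb (h : Admissible a b c σ) {T : ℝ} (hT : 0 ≤ T) (i j) :
    IntervalIntegrable (fun r => (b r * (b r)ᵀ) i j) volume 0 T := by
  have : ∀ k, IntervalIntegrable (fun r => b r i k * b r j k) volume 0 T := fun k => by
    rw [intervalIntegrable_iff_integrableOn_Icc_of_le hT]
    exact (h.memLp_b hT i k).integrable_mul (h.memLp_b hT j k)
  have := IntervalIntegrable.sum Finset.univ fun k (_ : k ∈ Finset.univ) => this k
  simpa only [Matrix.mul_apply, Matrix.transpose_apply, Finset.sum_fn] using this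

theorem IsBackwardRiccati.continuousOn {φ : ℝ → ℝ → Matrix (Fin d₁) (Fin d₁) ℝ}
    (hφ : IsBackwardRiccati a b c σ φ) {t : ℝ} (ht : 0 ≤ t) (i j) :
    ContinuousOn (fun s => φ t s i j) (Icc 0 t) := (hφ.eqn t ht).continuousOn ht i j

theorem IsBackwardRiccati.transpose_eq {φ : ℝ → ℝ → Matrix (Fin d₁) (Fin d₁) ℝ}
    (hφ : IsBackwardRiccati a b c σ φ) {t s : ℝ} (ht : 0 ≤ t) (hs : s ∈ Icc 0 t) :
    (φ t s)ᵀ = φ t s := by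
  have := (hφ.negSemidef t ht s hs).isHermitian
  rw [Matrix.IsHermitian, Matrix.conjTranspose_eq_transpose_of_trivial,
    Matrix.transpose_neg] at this
  exact neg_injective this

/-- The drift coefficient of the smoothing equation is integrable. -/
theorem IsBackwardRiccati.intervalIntegrable_drift {φ : ℝ → ℝ → Matrix (Fin d₁) (Fin d₁) ℝ}
    (hφ : IsBackwardRiccati a b c σ φ) (h : Admissible a b c σ) {t : ℝ} (ht : 0 ≤ t) (i j) :
    IntervalIntegrable (fun s => (a s + b s * (b s)ᵀ * φ t s) i j) volume 0 t :=
  (h.intervalIntegrable_a ht i j).add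
    (intervalIntegrable_mul_of_continuousOn ht (h.intervalIntegrable_bb ht)
      (hφ.continuousOn ht) i j)

/-- Integrability of `cᵀ (σ σᵀ)⁻¹ c`, read off from the backward Riccati equation, all of whose
other terms are integrable. -/
theorem IsBackwardRiccati.intervalIntegrable_obs {φ : ℝ → ℝ → Matrix (Fin d₁) (Fin d₁) ℝ}
    (hφ : IsBackwardRiccati a b c σ φ) (h : Admissible a b c σ) {t : ℝ} (ht : 0 ≤ t) (i j) :
    IntervalIntegrable (fun s => obs c σ s i j) volume 0 t := by
  have h1 := (hφ.eqn t ht i j).1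
  have h2 := intervalIntegrable_mul_of_continuousOn ht (intervalIntegrable_continuousOn_mul ht
    (hφ.continuousOn ht) (h.intervalIntegrable_bb ht)) (hφ.continuousOn ht) i j
  have h3 := intervalIntegrable_mul_of_continuousOn (f := fun s => (a s)ᵀ) ht
    (fun i j => h.intervalIntegrable_a ht j i) (hφ.continuousOn ht) i j
  have h4 := intervalIntegrable_continuousOn_mul ht
    (hφ.continuousOn ht) (h.intervalIntegrable_a ht) i j
  refine (((h1.add h2).add h3).add h4).congr fun s _ => ?_
  simp only [Matrix.add_apply, Matrix.sub_apply, Matrix.neg_apply]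
  ring

/-- The coefficient of the filter dynamics is integrable. -/
theorem IsForwardRiccati.intervalIntegrable_drift {φ : ℝ → ℝ → Matrix (Fin d₁) (Fin d₁) ℝ}
    {Γ₀ : Matrix (Fin d₁) (Fin d₁) ℝ} {γ : ℝ → Matrix (Fin d₁) (Fin d₁) ℝ}
    (hγ : IsForwardRiccati a b c σ Γ₀ γ) (hφ : IsBackwardRiccati a b c σ φ)
    (h : Admissible a b c σ) {t : ℝ} (ht : 0 ≤ t) (i j) :
    IntervalIntegrable (fun s => (a s - γ s * obs c σ s) i j) volume 0 t :=
  (h.intervalIntegrable_a ht i j).sub (intervalIntegrable_continuousOn_mul ht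
    ((hγ.eqn t ht).continuousOn ht) (hφ.intervalIntegrable_obs h ht) i j)

/-! ### The two Riccati equations -/

section Sqrt

open scoped MatrixOrder

theorem matSqrt_mul_self {d : ℕ} {A : Matrix (Fin d) (Fin d) ℝ} (hA : A.PosSemidef) :
    matSqrt A * matSqrt A = A := CFC.sqrt_mul_sqrt_self A hA.nonneg

theorem posSemidef_matSqrt {d : ℕ} (A : Matrix (Fin d) (Fin d) ℝ) : (matSqrt A).PosSemidef :=
  Matrix.nonneg_iff_posSemidef.1 (CFC.sqrt_nonneg A)

end Sqrt

/-- `initialCov Γ φ = (1 - Γ φ)⁻¹ Γ`, in a form without inverse. -/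
theorem one_sub_mul_initialCov {d : ℕ} {Γ φ : Matrix (Fin d) (Fin d) ℝ} (hΓ : Γ.PosSemidef)
    (hφ : (-φ).PosSemidef) : (1 - Γ * φ) * initialCov Γ φ = Γ := by
  set S := matSqrt Γ with hS
  have hSS : S * S = Γ := matSqrt_mul_self hΓ
  have hSt : Sᴴ = S := (posSemidef_matSqrt Γ).isHermitian
  have hpd : (1 - S * φ * S).PosDef := by
    have h1 := hφ.mul_mul_conjTranspose_same S
    have h2 := (Matrix.PosDef.one (n := Fin d) (R := ℝ)).add_posSemidef h1
    rw [hSt] at h2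
    have e : 1 + S * -φ * S = 1 - S * φ * S := by noncomm_ring
    rwa [e] at h2
  have hu : IsUnit (1 - S * φ * S).det := (Matrix.isUnit_iff_isUnit_det _).1 hpd.isUnit
  calc (1 - Γ * φ) * initialCov Γ φ
      = S * ((1 - S * φ * S) * (1 - S * φ * S)⁻¹) * S := by
        rw [initialCov, ← hS, ← hSS]; noncomm_ring
    _ = Γ := by rw [Matrix.mul_nonsing_inv _ hu, mul_one, hSS]

variable {φ : ℝ → ℝ → Matrix (Fin d₁) (Fin d₁) ℝ}
  {Γ₀ : Matrix (Fin d₁) (Fin d₁) ℝ} {γ : ℝ → Matrix (Fin d₁) (Fin d₁) ℝ}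

/-- `1 - γ φ` intertwines the smoothing dynamics with the filter dynamics:
`N = 1 - γ φ` solves `N' = (a - γ R) N - N (a + b bᵀ φ)`. -/
theorem hasIntegralDerivOn_one_sub_mul (hφ : IsBackwardRiccati a b c σ φ)
    (hγ : IsForwardRiccati a b c σ Γ₀ γ) {t : ℝ} (ht : 0 ≤ t) :
    HasIntegralDerivOn (fun s => 1 - γ s * φ t s)
      (fun s => (a s - γ s * obs c σ s) * (1 - γ s * φ t s) -
        (1 - γ s * φ t s) * (a s + b s * (b s)ᵀ * φ t s)) 0 t := by
  refine ((hasIntegralDerivOn_const 1).add ((hγ.eqn t ht).mul (hφ.eqn t ht) ht).neg).congr ht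
    (fun s _ => by rw [sub_eq_add_neg]) fun s _ => ?_
  generalize b s * (b s)ᵀ = β
  generalize obs c σ s = R
  noncomm_ring

/-- The algebraic identity behind the theorem. Let `Ψ`, `Θ` be the fundamental solution of the
smoothing dynamics and its inverse, and `Φ`, `Λ` those of the filter dynamics. Then
`Ψ t G s (Ψ s)ᵀ`, the cross-covariance of the smoothing process, is the filter
transition matrix `Φ t Λ s` applied to `γ s`. -/
theorem fundamental_solution_mul_eq (hφ : IsBackwardRiccati a b c σ φ)
    (hγ : IsForwardRiccati a b c σ Γ₀ γ) {t : ℝ} (ht : 0 ≤ t)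
    {Ψ Θ Φ Λ G : ℝ → Matrix (Fin d₁) (Fin d₁) ℝ} (hΨ0 : Ψ 0 = 1) (hΘ0 : Θ 0 = 1)
    (hΛ0 : Λ 0 = 1)
    (hΨ : HasIntegralDerivOn Ψ (fun s => (a s + b s * (b s)ᵀ * φ t s) * Ψ s) 0 t)
    (hΘ : HasIntegralDerivOn Θ (fun s => -(Θ s * (a s + b s * (b s)ᵀ * φ t s))) 0 t)
    (hΛ : HasIntegralDerivOn Λ (fun s => -(Λ s * (a s - γ s * obs c σ s))) 0 t)
    (hΘΨ : ∀ s ∈ Icc 0 t, Θ s * Ψ s = 1) (hΦΛ : ∀ s ∈ Icc 0 t, Φ s * Λ s = 1)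
    (hG : HasIntegralDerivOn G (fun s => Θ s * (b s * (b s)ᵀ) * (Θ s)ᵀ) 0 t)
    (hG0 : G 0 = initialCov Γ₀ (φ t 0)) {s : ℝ} (hs : s ∈ Icc 0 t) :
    Ψ t * G s * (Ψ s)ᵀ = Φ t * Λ s * γ s := by
  have ht' : t ∈ Icc 0 t := ⟨ht, le_rfl⟩
  have h0' : (0 : ℝ) ∈ Icc 0 t := ⟨le_rfl, ht⟩
  set N : ℝ → Matrix (Fin d₁) (Fin d₁) ℝ := fun s => 1 - γ s * φ t s with hN
  have hN' := hasIntegralDerivOn_one_sub_mul hφ hγ ht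
  -- `Λ N Ψ` is constant
  have hconst : ∀ r ∈ Icc 0 t, Λ r * N r * Ψ r = N 0 := by
    intro r hr
    refine HasIntegralDerivOn.eq_of_eq (f := fun _ => 0) (N := fun _ => N 0)
      (((hΛ.mul hN' ht).mul hΨ ht).congr ht (fun _ _ => rfl) fun z _ => ?_)
      (hasIntegralDerivOn_const (N 0)) (by simp [hΛ0, hΨ0, hN]) hr
    generalize b z * (b z)ᵀ = β
    generalize obs c σ z = R
    noncomm_ring
  have hNt : N t = 1 := by simp [hN, hφ.terminal t ht]
  have hΨt : Ψ t = Φ t * N 0 := by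
    rw [← hconst t ht', hNt, mul_one, ← mul_assoc, hΦΛ t ht', one_mul]
  have hΛN : ∀ r ∈ Icc 0 t, Λ r * N r = N 0 * Θ r := by
    intro r hr
    rw [← hconst r hr, mul_assoc (Λ r * N r), mul_eq_one_comm.1 (hΘΨ r hr), mul_one]
  -- `N 0 * G` and `Λ γ Θᵀ` have the same derivative and the same initial value
  have hγG : ∀ r ∈ Icc 0 t, Λ r * γ r * (Θ r)ᵀ = N 0 * G r := by
    intro r hr
    refine HasIntegralDerivOn.eq_of_eq
      (((hΛ.mul (hγ.eqn t ht) ht).mul hΘ.transpose ht).congr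
        (g := fun z => N 0 * (Θ z * (b z * (b z)ᵀ) * (Θ z)ᵀ)) ht (fun _ _ => rfl) fun z hz => ?_)
      (hG.const_mul ht (N 0)) ?_ hr
    · have e := hΛN z hz
      have e2 : N 0 * (Θ z * (b z * (b z)ᵀ) * (Θ z)ᵀ) = N 0 * Θ z * (b z * (b z)ᵀ) * (Θ z)ᵀ := by
        simp only [mul_assoc]
      have e3 : (b z * (b z)ᵀ)ᵀ = b z * (b z)ᵀ := by simp
      rw [e2, ← e, hN]
      simp only [Matrix.transpose_neg, Matrix.transpose_mul, Matrix.transpose_add,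
        hφ.transpose_eq ht hz, Matrix.transpose_transpose]
      generalize b z * (b z)ᵀ = β
      generalize obs c σ z = R
      generalize (a z)ᵀ = a'
      noncomm_ring
    · rw [hΛ0, hΘ0, hG0, hγ.initial, one_mul, Matrix.transpose_one, mul_one]
      change Γ₀ = (1 - γ 0 * φ t 0) * initialCov Γ₀ (φ t 0)
      rw [hγ.initial]
      exact (one_sub_mul_initialCov (hγ.initial ▸ hγ.posSemidef 0 le_rfl)
        (hφ.negSemidef t ht 0 h0')).symm
  have hΘΨt : (Θ s)ᵀ * (Ψ s)ᵀ = 1 := by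
    rw [← Matrix.transpose_mul, mul_eq_one_comm.1 (hΘΨ s hs), Matrix.transpose_one]
  rw [hΨt, mul_assoc (Φ t), ← hγG s hs, mul_assoc (Φ t), mul_assoc (Λ s * γ s), hΘΨt, mul_one,
    mul_assoc (Φ t)]

/-! ### Covariances under `L²` convergence -/

theorem tendsto_integral_mul_of_tendsto_eLpNorm {α : Type*} [MeasurableSpace α] {μ : Measure α}
    {X Y : ℕ → α → ℝ} {x y : α → ℝ} (hX : ∀ n, MemLp (X n) 2 μ) (hY : ∀ n, MemLp (Y n) 2 μ)
    (hx : MemLp x 2 μ) (hy : MemLp y 2 μ)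
    (hXx : Tendsto (fun n => eLpNorm (X n - x) 2 μ) atTop (𝓝 0))
    (hYy : Tendsto (fun n => eLpNorm (Y n - y) 2 μ) atTop (𝓝 0)) :
    Tendsto (fun n => ∫ z, X n z * Y n z ∂μ) atTop (𝓝 (∫ z, x z * y z ∂μ)) := by
  have h1 := (Lp.tendsto_Lp_iff_tendsto_eLpNorm'' X hX x hx).2 hXx
  have h2 := (Lp.tendsto_Lp_iff_tendsto_eLpNorm'' Y hY y hy).2 hYy
  have key : ∀ {u v : α → ℝ} (hu : MemLp u 2 μ) (hv : MemLp v 2 μ),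
      inner ℝ (hu.toLp u) (hv.toLp v) = ∫ z, u z * v z ∂μ := by
    intro u v hu hv
    rw [L2.inner_def]
    refine integral_congr_ae ?_
    filter_upwards [hu.coeFn_toLp, hv.coeFn_toLp] with z h1 h2
    rw [h1, h2]; simp [mul_comm]
  have := h1.inner (𝕜 := ℝ) h2
  simpa only [key] using this

theorem tendsto_covariance_of_tendsto_eLpNorm {Ω : Type*} [MeasurableSpace Ω] {P : Measure Ω}
    [IsProbabilityMeasure P]
    {X Y : ℕ → Ω → ℝ} {x y : Ω → ℝ} (hX : ∀ n, MemLp (X n) 2 P) (hY : ∀ n, MemLp (Y n) 2 P)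
    (hx : MemLp x 2 P) (hy : MemLp y 2 P)
    (hXx : Tendsto (fun n => eLpNorm (X n - x) 2 P) atTop (𝓝 0))
    (hYy : Tendsto (fun n => eLpNorm (Y n - y) 2 P) atTop (𝓝 0)) :
    Tendsto (fun n => cov[X n, Y n; P]) atTop (𝓝 cov[x, y; P]) := by
  have h1 : MemLp (fun _ : Ω => (1 : ℝ)) 2 P := memLp_const 1
  have hmean : ∀ {Z : ℕ → Ω → ℝ} {z : Ω → ℝ}, (∀ n, MemLp (Z n) 2 P) → MemLp z 2 P →
      Tendsto (fun n => eLpNorm (Z n - z) 2 P) atTop (𝓝 0) →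
      Tendsto (fun n => ∫ ω, Z n ω ∂P) atTop (𝓝 (∫ ω, z ω ∂P)) := by
    intro Z z hZ hz h
    simpa using tendsto_integral_mul_of_tendsto_eLpNorm hZ (fun _ => h1) hz h1 h (by simp)
  rw [covariance_eq_sub hx hy]
  simp_rw [fun n => covariance_eq_sub (hX n) (hY n)]
  exact (tendsto_integral_mul_of_tendsto_eLpNorm hX hY hx hy hXx hYy).sub
    ((hmean hX hx hXx).mul (hmean hY hy hYy))

/-! ### Covariances of Wiener integrals -/

theorem StepFun.eval_apply {p m : ℕ} (g : StepFun p m) (r : ℝ) (i : Fin p) (j : Fin m) :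
    g.eval r i j = ∑ k ∈ Finset.range g.n, g.A k i j *
      (Ioc (g.τ k : ℝ) (g.τ (k + 1))).indicator (1 : ℝ → ℝ) r := by
  rw [StepFun.eval, Matrix.sum_apply]
  refine Finset.sum_congr rfl fun k _ => ?_
  by_cases h : r ∈ Ioc (g.τ k : ℝ) (g.τ (k + 1)) <;> simp [h]

theorem StepFun.integral_apply {Ω : Type*} {p m : ℕ} {B : Fin m → ℝ≥0 → Ω → ℝ} (g : StepFun p m)
    (s : ℝ≥0) (ω : Ω) (i : Fin p) :
    g.integral B s ω i = ∑ k ∈ Finset.range g.n ×ˢ Finset.univ, g.A k.1 i k.2 *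
      (B k.2 (min (g.τ (k.1 + 1)) s) ω - B k.2 (min (g.τ k.1) s) ω) := by
  rw [StepFun.integral, Finset.sum_apply, Finset.sum_product]
  rfl

section

variable {Ω : Type*} [MeasurableSpace Ω] {P : Measure Ω} {m p q : ℕ} {B : Fin m → ℝ≥0 → Ω → ℝ}

theorem IsBrownianVec.memLp (hB : IsBrownianVec B P) (j : Fin m) (r : ℝ≥0) :
    MemLp (B j r) 2 P :=
  ((hB.brownian j).hasLaw_eval r).hasGaussianLaw.memLp_two

theorem IsBrownianVec.covariance_eq (hB : IsBrownianVec B P) (i j : Fin m) (r s : ℝ≥0) :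
    cov[B i r, B j s; P] = if i = j then ((min r s : ℝ≥0) : ℝ) else 0 := by
  split_ifs with h
  · subst h
    exact (hB.brownian i).covariance_eval r s
  · exact ((hB.indep.indepFun h).comp (measurable_pi_apply r)
      (measurable_pi_apply s)).covariance_eq_zero
      (hB.memLp i r) (hB.memLp j s)

/-- The `L²`-isometry for indicators of intervals: on `[0, z]`, `B_x` corresponds to the indicator
of `(0, x]`. -/
theorem integral_indicator_sub_mul_indicator_sub (x x' y y' z : ℝ≥0) (hx : x ≤ x') (hy : y ≤ y') :
    ∫ r in Icc 0 (z : ℝ),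
        (Ioc (x : ℝ) x').indicator 1 r * (Ioc (y : ℝ) y').indicator (1 : ℝ → ℝ) r =
      min (min (x' : ℝ) y') z - min (min (x' : ℝ) y) z - min (min (x : ℝ) y') z
        + min (min (x : ℝ) y) z := by
  have hint : ∀ u v : ℝ≥0, ∫ r in Icc 0 (z : ℝ), (Ioc (0 : ℝ) u).indicator 1 r *
      (Ioc (0 : ℝ) v).indicator (1 : ℝ → ℝ) r = min (min (u : ℝ) v) z := by
    intro u v
    have e : (fun r => (Ioc (0 : ℝ) u).indicator 1 r * (Ioc (0 : ℝ) v).indicator (1 : ℝ → ℝ) r) =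
        (Ioc (0 : ℝ) u ∩ Ioc (0 : ℝ) v).indicator (1 : ℝ → ℝ) := by
      rw [inter_indicator_one]; rfl
    rw [integral_Icc_eq_integral_Ioc, e,
      integral_indicator_one (measurableSet_Ioc.inter measurableSet_Ioc), measureReal_restrict_apply
        (measurableSet_Ioc.inter measurableSet_Ioc), Ioc_inter_Ioc, Ioc_inter_Ioc]
    simp
  have hi : ∀ u v : ℝ≥0, Integrable (fun r => (Ioc (0 : ℝ) u).indicator 1 r *
      (Ioc (0 : ℝ) v).indicator (1 : ℝ → ℝ) r) (volume.restrict (Icc 0 (z : ℝ))) := by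
    have h : ∀ u : ℝ≥0, MemLp ((Ioc (0 : ℝ) u).indicator (1 : ℝ → ℝ)) 2
        (volume.restrict (Icc 0 (z : ℝ))) := fun u =>
      (memLp_const (1 : ℝ)).indicator measurableSet_Ioc
    exact fun u v => (h u).integrable_mul (h v)
  have hsub : ∀ {u u' : ℝ≥0}, u ≤ u' → ∀ r, (Ioc (u : ℝ) u').indicator (1 : ℝ → ℝ) r =
      (Ioc (0 : ℝ) u').indicator 1 r - (Ioc (0 : ℝ) u).indicator 1 r := by
    intro u u' h r
    have h' : (u : ℝ) ≤ u' := h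
    have h0 := u.2
    simp only [indicator_apply, mem_Ioc, Pi.one_apply]
    have h00 : (0 : ℝ) ≤ u := u.2
    split_ifs <;> grind
  have e : ∀ r, (Ioc (x : ℝ) x').indicator 1 r * (Ioc (y : ℝ) y').indicator (1 : ℝ → ℝ) r =
      (Ioc (0 : ℝ) x').indicator 1 r * (Ioc (0 : ℝ) y').indicator 1 r
      - (Ioc (0 : ℝ) x').indicator 1 r * (Ioc (0 : ℝ) y).indicator 1 r
      - (Ioc (0 : ℝ) x).indicator 1 r * (Ioc (0 : ℝ) y').indicator 1 r
      + (Ioc (0 : ℝ) x).indicator 1 r * (Ioc (0 : ℝ) y).indicator 1 r := by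
    intro r; rw [hsub hx, hsub hy]; ring
  simp_rw [e]
  have h2 := (hi x' y').sub (hi x' y)
  have h3 := h2.sub (hi x y')
  rw [integral_add (by exact h3) (hi x y), integral_sub (by exact h2) (hi x y'),
    integral_sub (hi x' y') (hi x' y)]
  simp only [hint]

theorem StepFun.memLp_eval (g : StepFun p m) (μ : Measure ℝ) [IsFiniteMeasure μ] (i : Fin p)
    (j : Fin m) : MemLp (fun r => g.eval r i j) 2 μ := by
  simp_rw [StepFun.eval_apply]
  exact memLp_finsetSum _ fun k _ =>
    ((memLp_const (1 : ℝ)).indicator measurableSet_Ioc).const_mul _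

theorem StepFun.memLp_integral (hB : IsBrownianVec B P) (g : StepFun p m) (s : ℝ≥0) (i : Fin p) :
    MemLp (fun ω => g.integral B s ω i) 2 P := by
  simp_rw [StepFun.integral_apply]
  exact memLp_finsetSum _ fun k _ => ((hB.memLp _ _).sub (hB.memLp _ _)).const_mul _

/-- The Itô isometry for step functions, polarized and with possibly different upper limits. -/
theorem StepFun.covariance_integral [IsProbabilityMeasure P] (hB : IsBrownianVec B P)
    (g : StepFun p m) (h : StepFun q m) (s u : ℝ≥0) (i : Fin p) (j : Fin q) :
    cov[fun ω => g.integral B s ω i, fun ω => h.integral B u ω j; P] =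
      ∑ l, ∫ r in Icc 0 ((min s u : ℝ≥0) : ℝ), g.eval r i l * h.eval r j l := by
  simp_rw [StepFun.integral_apply]
  have hL : ∀ (c : ℝ) (l : Fin m) (x y : ℝ≥0), MemLp (fun ω => c * (B l x ω - B l y ω)) 2 P :=
    fun c l x y => ((hB.memLp l x).sub (hB.memLp l y)).const_mul c
  rw [covariance_fun_sum_fun_sum' (fun k _ => hL _ _ _ _) (fun k _ => hL _ _ _ _)]
  have key : ∀ k k' : ℕ × Fin m,
      cov[fun ω => g.A k.1 i k.2 *
        (B k.2 (min (g.τ (k.1 + 1)) s) ω - B k.2 (min (g.τ k.1) s) ω),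
        fun ω => h.A k'.1 j k'.2 *
        (B k'.2 (min (h.τ (k'.1 + 1)) u) ω - B k'.2 (min (h.τ k'.1) u) ω); P] =
      if k.2 = k'.2 then ∫ r in Icc 0 ((min s u : ℝ≥0) : ℝ),
        (g.A k.1 i k.2 * (Ioc (g.τ k.1 : ℝ) (g.τ (k.1 + 1))).indicator (1 : ℝ → ℝ) r) *
        (h.A k'.1 j k'.2 * (Ioc (h.τ k'.1 : ℝ) (h.τ (k'.1 + 1))).indicator (1 : ℝ → ℝ) r)
      else 0 := by
    intro k k'
    rw [covariance_const_mul_left, covariance_const_mul_right, covariance_fun_sub_fun_sub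
      (hB.memLp _ _) (hB.memLp _ _) (hB.memLp _ _) (hB.memLp _ _)]
    simp only [hB.covariance_eq]
    split_ifs
    · have e : ∀ r, (g.A k.1 i k.2 * (Ioc (g.τ k.1 : ℝ) (g.τ (k.1 + 1))).indicator (1 : ℝ → ℝ) r) *
          (h.A k'.1 j k'.2 * (Ioc (h.τ k'.1 : ℝ) (h.τ (k'.1 + 1))).indicator (1 : ℝ → ℝ) r) =
          (g.A k.1 i k.2 * h.A k'.1 j k'.2) *
          ((Ioc (g.τ k.1 : ℝ) (g.τ (k.1 + 1))).indicator (1 : ℝ → ℝ) r *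
          (Ioc (h.τ k'.1 : ℝ) (h.τ (k'.1 + 1))).indicator (1 : ℝ → ℝ) r) := fun r => by ring
      simp_rw [e]
      rw [integral_const_mul, integral_indicator_sub_mul_indicator_sub _ _ _ _ _
        (g.mono k.1.le_succ) (h.mono k'.1.le_succ)]
      push_cast
      simp only [min_min_min_comm _ (s : ℝ) _ (u : ℝ)]
      ring
    · ring
  simp only [key]
  have hint : ∀ l k k', Integrable (fun r =>
      (g.A k i l * (Ioc (g.τ k : ℝ) (g.τ (k + 1))).indicator (1 : ℝ → ℝ) r) *
      (h.A k' j l * (Ioc (h.τ k' : ℝ) (h.τ (k' + 1))).indicator (1 : ℝ → ℝ) r))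
      (volume.restrict (Icc 0 ((min s u : ℝ≥0) : ℝ))) := fun l k k' =>
    (((memLp_const (1 : ℝ)).indicator measurableSet_Ioc).const_mul _).integrable_mul
      (((memLp_const (1 : ℝ)).indicator measurableSet_Ioc).const_mul _) (p := 2) (q := 2)
  simp_rw [StepFun.eval_apply, Finset.sum_mul_sum]
  simp only [Finset.sum_product]
  rw [Finset.sum_comm]
  refine Finset.sum_congr rfl fun l _ => ?_
  rw [integral_finsetSum _ fun k _ => integrable_finsetSum _ fun k' _ => hint l k k']
  refine Finset.sum_congr rfl fun k _ => ?_
  rw [integral_finsetSum _ fun k' _ => hint l k k']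
  refine Finset.sum_congr rfl fun k' _ => ?_
  simp

end

section

variable {Ω : Type*} [MeasurableSpace Ω] {P : Measure Ω} {m p : ℕ} {B : Fin m → ℝ≥0 → Ω → ℝ}

/-- The approximation of a Wiener integral by elementary integrals, read entrywise. -/
theorem IsWienerIntegral.exists_approx {f : ℝ → Matrix (Fin p) (Fin m) ℝ} {s : ℝ}
    {I : Ω → Fin p → ℝ} (hI : IsWienerIntegral B P f s I) :
    ∃ g : ℕ → StepFun p m,
      (∀ i j, Tendsto (fun n => eLpNorm ((fun r => (g n).eval r i j) - fun r => f r i j) 2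
        (volume.restrict (Icc 0 s))) atTop (𝓝 0)) ∧
      ∀ i, Tendsto (fun n => eLpNorm ((fun ω => (g n).integral B s.toNNReal ω i) -
        fun ω => I ω i) 2 P) atTop (𝓝 0) := by
  obtain ⟨g, h1, h2⟩ := hI
  refine ⟨g, fun i j => ?_, fun i => ?_⟩
  · have h3 := (ENNReal.continuous_rpow_const (y := 1 / 2)).tendsto 0 |>.comp h1
    rw [ENNReal.zero_rpow_of_pos (by norm_num)] at h3
    refine tendsto_of_tendsto_of_tendsto_of_le_of_le tendsto_const_nhds h3
      (fun _ => zero_le) fun n => ?_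
    rw [eLpNorm_eq_lintegral_rpow_enorm_toReal two_ne_zero ENNReal.ofNat_ne_top]
    simp only [ENNReal.toReal_ofNat, Function.comp_apply]
    refine ENNReal.rpow_le_rpow (lintegral_mono fun r => ?_) (by norm_num)
    rw [Real.enorm_eq_ofReal_abs, ENNReal.ofReal_rpow_of_nonneg (abs_nonneg _) two_pos.le]
    refine ENNReal.ofReal_le_ofReal ?_
    rw [Real.rpow_two]
    exact pow_le_pow_left₀ (abs_nonneg _) (abs_apply_le_frob ((g n).eval r - f r) i j) 2
  · refine tendsto_of_tendsto_of_tendsto_of_le_of_le tendsto_const_nhds h2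
      (fun _ => zero_le) fun n => ?_
    exact eLpNorm_mono fun ω =>
      norm_le_pi_norm ((g n).integral B s.toNNReal ω - I ω) i

theorem IsWienerIntegral.memLp (hB : IsBrownianVec B P) {f : ℝ → Matrix (Fin p) (Fin m) ℝ} {s : ℝ}
    {I : Ω → Fin p → ℝ} (hI : IsWienerIntegral B P f s I) (i : Fin p)
    (hm : AEStronglyMeasurable (fun ω => I ω i) P) : MemLp (fun ω => I ω i) 2 P := by
  obtain ⟨g, -, h2⟩ := hI.exists_approx
  obtain ⟨n, hn⟩ := ((h2 i).eventually (gt_mem_nhds zero_lt_one)).exists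
  have hg := (g n).memLp_integral hB s.toNNReal i
  have hd : MemLp ((fun ω => (g n).integral B s.toNNReal ω i) - fun ω => I ω i) 2 P :=
    ⟨hg.aestronglyMeasurable.sub hm, hn.trans ENNReal.one_lt_top⟩
  convert hg.sub hd using 1
  simp

/-- The Itô isometry for Wiener integrals of the same function up to different times. -/
theorem IsWienerIntegral.covariance_eq [IsProbabilityMeasure P] (hB : IsBrownianVec B P)
    {f : ℝ → Matrix (Fin p) (Fin m) ℝ} {s u : ℝ} (hs : 0 ≤ s) (hu : 0 ≤ u)
    (hf : ∀ i j, MemLp (fun r => f r i j) 2 (volume.restrict (Icc 0 (min s u))))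
    {I I' : Ω → Fin p → ℝ} (hI : IsWienerIntegral B P f s I) (hI' : IsWienerIntegral B P f u I')
    (i j : Fin p) (hm : MemLp (fun ω => I ω i) 2 P) (hm' : MemLp (fun ω => I' ω j) 2 P) :
    cov[fun ω => I ω i, fun ω => I' ω j; P] =
      ∫ r in (0 : ℝ)..min s u, (f r * (f r)ᵀ) i j := by
  obtain ⟨g, g1, g2⟩ := hI.exists_approx
  obtain ⟨h, h1, h2⟩ := hI'.exists_approx
  have l1 := tendsto_covariance_of_tendsto_eLpNorm
    (fun n => (g n).memLp_integral hB s.toNNReal i)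
    (fun n => (h n).memLp_integral hB u.toNNReal j) hm hm' (g2 i) (h2 j)
  simp_rw [StepFun.covariance_integral hB] at l1
  have hmin : ((min s.toNNReal u.toNNReal : ℝ≥0) : ℝ) = min s u := by
    rw [NNReal.coe_min, Real.coe_toNNReal _ hs, Real.coe_toNNReal _ hu]
  rw [hmin] at l1
  have hle : ∀ {x : ℝ} {X : ℕ → ℝ → ℝ}, min s u ≤ x →
      Tendsto (fun n => eLpNorm (X n) 2 (volume.restrict (Icc 0 x))) atTop (𝓝 0) →
      Tendsto (fun n => eLpNorm (X n) 2 (volume.restrict (Icc 0 (min s u)))) atTop (𝓝 0) :=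
    fun hx h => tendsto_of_tendsto_of_tendsto_of_le_of_le tendsto_const_nhds h
      (fun _ => zero_le) fun n =>
        eLpNorm_mono_measure _ (Measure.restrict_mono (Icc_subset_Icc_right hx) le_rfl)
  have l2 := tendsto_finsetSum Finset.univ fun l (_ : l ∈ Finset.univ) =>
    tendsto_integral_mul_of_tendsto_eLpNorm (μ := volume.restrict (Icc 0 (min s u)))
      (fun n => (g n).memLp_eval _ i l) (fun n => (h n).memLp_eval _ j l) (hf i l) (hf j l)
      (hle (min_le_left _ _) (g1 i l)) (hle (min_le_right _ _) (h1 j l))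
  rw [tendsto_nhds_unique l1 l2, intervalIntegral.integral_of_le (le_min hs hu),
    ← integral_Icc_eq_integral_Ioc]
  simp only [Matrix.mul_apply, Matrix.transpose_apply]
  exact (integral_finsetSum _ fun l _ => (hf i l).integrable_mul (hf j l)).symm

theorem IsWienerIntegral.integral_eq_zero [IsProbabilityMeasure P] (hB : IsBrownianVec B P)
    {f : ℝ → Matrix (Fin p) (Fin m) ℝ} {s : ℝ} {I : Ω → Fin p → ℝ}
    (hI : IsWienerIntegral B P f s I) (i : Fin p) (hm : MemLp (fun ω => I ω i) 2 P) :
    ∫ ω, I ω i ∂P = 0 := by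
  obtain ⟨g, -, g2⟩ := hI.exists_approx
  have h1 : MemLp (fun _ : Ω => (1 : ℝ)) 2 P := memLp_const 1
  have l1 := tendsto_integral_mul_of_tendsto_eLpNorm
    (fun n => (g n).memLp_integral hB s.toNNReal i) (fun _ => h1) hm h1 (g2 i) (by simp)
  simp only [mul_one] at l1
  refine tendsto_nhds_unique l1 (tendsto_const_nhds.congr fun n => ?_)
  have hB1 : ∀ l r, Integrable (B l r) P := fun l r => (hB.brownian l).integrable_eval r
  have hB0 : ∀ l r, ∫ ω, B l r ω ∂P = 0 := fun l r => (hB.brownian l).integral_eval r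
  simp_rw [StepFun.integral_apply]
  have hd : ∀ (c : ℝ) (l : Fin m) (x y : ℝ≥0), Integrable (fun ω => c * (B l x ω - B l y ω)) P :=
    fun c l x y => ((hB1 l x).sub (hB1 l y)).const_mul c
  rw [integral_finsetSum _ fun k _ => hd _ _ _ _]
  refine (Finset.sum_eq_zero fun k _ => ?_).symm
  rw [integral_const_mul, integral_sub (hB1 _ _) (hB1 _ _), hB0, hB0, sub_zero, mul_zero]

theorem IsWienerIntegral.congr {f : ℝ → Matrix (Fin p) (Fin m) ℝ} {s : ℝ} {I I' : Ω → Fin p → ℝ}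
    (hI : IsWienerIntegral B P f s I) (h : I =ᵐ[P] I') : IsWienerIntegral B P f s I' := by
  obtain ⟨g, h1, h2⟩ := hI
  refine ⟨g, h1, h2.congr fun n => eLpNorm_congr_ae ?_⟩
  filter_upwards [h] with ω hω
  rw [hω]

/-- Wiener integrals are uncorrelated with random variables independent of the Brownian motion. -/
theorem IsWienerIntegral.covariance_eq_zero [IsProbabilityMeasure P] (hB : IsBrownianVec B P)
    {f : ℝ → Matrix (Fin p) (Fin m) ℝ} {s : ℝ} {I : Ω → Fin p → ℝ}
    (hI : IsWienerIntegral B P f s I) (i : Fin p) (hm : MemLp (fun ω => I ω i) 2 P)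
    {Z : Ω → ℝ} (hZ : MemLp Z 2 P)
    (hind : IndepFun Z (fun ω (j : Fin m) (r : ℝ≥0) => B j r ω) P) :
    cov[fun ω => I ω i, Z; P] = 0 := by
  obtain ⟨g, -, g2⟩ := hI.exists_approx
  have l1 := tendsto_covariance_of_tendsto_eLpNorm
    (fun n => (g n).memLp_integral hB s.toNNReal i) (fun _ => hZ) hm hZ (g2 i) (by simp)
  refine tendsto_nhds_unique l1 (tendsto_const_nhds.congr fun n => ?_)
  have hmeas : Measurable fun β : Fin m → ℝ≥0 → ℝ =>
      ∑ k ∈ Finset.range (g n).n ×ˢ Finset.univ, (g n).A k.1 i k.2 *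
        (β k.2 (min ((g n).τ (k.1 + 1)) s.toNNReal) - β k.2 (min ((g n).τ k.1) s.toNNReal)) := by
    fun_prop
  have hi := (hind.comp measurable_id hmeas).symm
  have hg := (g n).memLp_integral hB s.toNNReal i
  simp_rw [StepFun.integral_apply] at hg ⊢
  exact (hi.covariance_eq_zero hg hZ).symm

end

/-! ### Time integrals of square integrable processes -/

section

variable {Ω : Type*} [MeasurableSpace Ω] {P : Measure Ω}

/-- A process with almost surely continuous paths on `[0, t]` agrees there, outside a null set that
does not depend on time, with a measurable process all of whose paths are continuous on the line. -/
theorem exists_continuous_modification {d : ℕ} {ξ : ℝ → Ω → Fin d → ℝ} {t : ℝ} (ht : 0 ≤ t)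
    (hm : ∀ s ∈ Icc 0 t, AEMeasurable (ξ s) P)
    (hc : ∀ᵐ ω ∂P, ContinuousOn (fun s => ξ s ω) (Icc 0 t)) :
    ∃ X : ℝ → Ω → Fin d → ℝ, (∀ s, Measurable (X s)) ∧ (∀ ω, Continuous fun s => X s ω) ∧
      ∀ᵐ ω ∂P, ∀ s ∈ Icc 0 t, X s ω = ξ s ω := by
  set π : ℝ → ℝ := fun s => projIcc 0 t ht s with hπ
  have hπc : Continuous π := continuous_subtype_val.comp continuous_projIcc
  have hπm : ∀ s, π s ∈ Icc 0 t := fun s => (projIcc 0 t ht s).2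
  have hπe : ∀ s ∈ Icc 0 t, π s = s := fun s hs => by simp [hπ, projIcc_of_mem ht hs]
  -- on `G` the path is continuous and agrees with measurable versions at all rational times
  have hae : ∀ᵐ ω ∂P, ContinuousOn (fun s => ξ s ω) (Icc 0 t) ∧
      ∀ q : ℚ, ξ (π q) ω = (hm (π q) (hπm q)).mk _ ω :=
    hc.and (ae_all_iff.2 fun q => (hm (π q) (hπm q)).ae_eq_mk)
  obtain ⟨G, hGae, hGm, hG⟩ := hae.exists_measurable_mem
  set X : ℝ → Ω → Fin d → ℝ := fun s => G.indicator (ξ (π s)) with hX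
  have hXc : ∀ ω, Continuous fun s => X s ω := by
    intro ω
    by_cases h : ω ∈ G
    · simp only [hX, indicator_of_mem h]
      exact (hG ω h).1.comp_continuous hπc hπm
    · simp only [hX, indicator_of_notMem h]
      exact continuous_const
  have hXq : ∀ q : ℚ, Measurable (X q) := by
    intro q
    have : X q = G.indicator ((hm (π q) (hπm q)).mk _) := by
      ext1 ω
      by_cases h : ω ∈ G
      · simp only [hX, indicator_of_mem h]; exact (hG ω h).2 q
      · simp only [hX, indicator_of_notMem h]
    rw [this]
    exact (hm (π q) (hπm q)).measurable_mk.indicator hGm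
  refine ⟨X, fun s => ?_, hXc, ?_⟩
  · obtain ⟨x, hx, hxs⟩ := mem_closure_iff_seq_limit.1 (Rat.denseRange_cast (𝕜 := ℝ) s)
    refine measurable_of_tendsto_metrizable (f := fun n => X (x n)) (fun n => ?_)
      (tendsto_pi_nhds.2 fun ω => ((hXc ω).tendsto s).comp hxs)
    obtain ⟨q, hq⟩ := hx n
    rw [← hq]; exact hXq q
  · filter_upwards [hGae] with ω hω s hs
    simp only [hX, indicator_of_mem hω, hπe s hs]

section

variable {k : ℝ → ℝ} {Y : ℝ → Ω → ℝ} {s : ℝ}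

theorem measurable_integral_mul (hs : 0 ≤ s) (hk : IntervalIntegrable k volume 0 s)
    (hYm : ∀ r, Measurable (Y r)) (hYc : ∀ ω, Continuous fun r => Y r ω) :
    Measurable fun ω => ∫ r in (0 : ℝ)..s, k r * Y r ω := by
  rw [intervalIntegrable_iff_integrableOn_Ioc_of_le hs] at hk
  have hkm := hk.aestronglyMeasurable
  have e : (fun ω => ∫ r in (0 : ℝ)..s, k r * Y r ω) =
      fun ω => ∫ r in Ioc 0 s, hkm.mk k r * Y r ω := by
    ext ω
    rw [intervalIntegral.integral_of_le hs]
    refine integral_congr_ae ?_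
    filter_upwards [hkm.ae_eq_mk] with r hr
    rw [hr]
  rw [e]
  have hY := stronglyMeasurable_uncurry_of_continuous_of_stronglyMeasurable hYc
    fun r => (hYm r).stronglyMeasurable
  refine (StronglyMeasurable.integral_prod_right (f := fun ω r => hkm.mk k r * Y r ω) ?_).measurable
  exact (hkm.stronglyMeasurable_mk.comp_measurable measurable_snd).mul
    (hY.comp_measurable measurable_swap)

/-- The Cauchy–Schwarz inequality for the measure `|k r| dr`. -/
theorem sq_integral_mul_le {y : ℝ → ℝ} (hs : 0 ≤ s) (hk : IntervalIntegrable k volume 0 s)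
    (hy : Continuous y) :
    (∫ r in (0 : ℝ)..s, k r * y r) ^ 2 ≤
      (∫ r in (0 : ℝ)..s, |k r|) * ∫ r in (0 : ℝ)..s, |k r| * y r ^ 2 := by
  set K := ∫ r in (0 : ℝ)..s, |k r|
  set S := ∫ r in (0 : ℝ)..s, |k r| * y r ^ 2
  set T := ∫ r in (0 : ℝ)..s, |k r| * |y r| with hT
  have i1 : IntervalIntegrable (fun r => |k r|) volume 0 s := hk.abs
  have i2 : IntervalIntegrable (fun r => |k r| * |y r|) volume 0 s :=
    i1.mul_continuousOn (by fun_prop)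
  have i3 : IntervalIntegrable (fun r => |k r| * y r ^ 2) volume 0 s :=
    i1.mul_continuousOn (by fun_prop)
  -- `∫ |k| (x - |y|)²` is a nonnegative quadratic polynomial in `x`
  have hd := discrim_le_zero (a := K) (b := -2 * T) (c := S) fun x => by
    have h0 : 0 ≤ ∫ r in (0 : ℝ)..s, |k r| * (x - |y r|) ^ 2 :=
      intervalIntegral.integral_nonneg hs fun r _ => by positivity
    have e : ∀ r, |k r| * (x - |y r|) ^ 2 =
        x * x * |k r| - 2 * x * (|k r| * |y r|) + |k r| * y r ^ 2 := fun r => by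
      rw [← sq_abs (y r)]; ring
    simp_rw [e] at h0
    rw [intervalIntegral.integral_add ((i1.const_mul _).sub (i2.const_mul _)) i3,
      intervalIntegral.integral_sub (i1.const_mul _) (i2.const_mul _),
      intervalIntegral.integral_const_mul, intervalIntegral.integral_const_mul] at h0
    linarith
  have hle : |∫ r in (0 : ℝ)..s, k r * y r| ≤ T := by
    rw [hT]
    simp_rw [← abs_mul]
    exact intervalIntegral.abs_integral_le_integral_abs hs
  have hsq := pow_le_pow_left₀ (abs_nonneg _) hle 2
  rw [sq_abs] at hsq
  rw [discrim] at hd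
  linarith

variable [IsProbabilityMeasure P]

/-- Joint integrability of `k r * Y r ω * Z ω` for a process `Y` bounded in `L²`. -/
theorem integrable_prod_mul_mul (hs : 0 ≤ s) (hk : IntervalIntegrable k volume 0 s)
    (hYm : ∀ r, Measurable (Y r)) (hYc : ∀ ω, Continuous fun r => Y r ω) {C : ℝ}
    (hY2 : ∀ r, MemLp (Y r) 2 P) (hYb : ∀ r, ∫ ω, Y r ω ^ 2 ∂P ≤ C) {Z : Ω → ℝ}
    (hZ : MemLp Z 2 P) :
    Integrable (fun z : ℝ × Ω => k z.1 * (Y z.1 z.2 * Z z.2))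
      ((volume.restrict (Ioc 0 s)).prod P) := by
  rw [intervalIntegrable_iff_integrableOn_Ioc_of_le hs] at hk
  have hY := stronglyMeasurable_uncurry_of_continuous_of_stronglyMeasurable hYc
    fun r => (hYm r).stronglyMeasurable
  have hmeas : AEStronglyMeasurable (fun z : ℝ × Ω => k z.1 * (Y z.1 z.2 * Z z.2))
      ((volume.restrict (Ioc 0 s)).prod P) :=
    hk.aestronglyMeasurable.comp_fst.mul
      (hY.aestronglyMeasurable.mul hZ.aestronglyMeasurable.comp_snd)
  rw [integrable_prod_iff hmeas]
  refine ⟨Eventually.of_forall fun r => ((hY2 r).integrable_mul hZ).const_mul (k r), ?_⟩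
  refine (hk.norm.mul_const ((C + ∫ ω, Z ω ^ 2 ∂P) / 2)).mono'
    hmeas.norm.integral_prod_right' (Eventually.of_forall fun r => ?_)
  simp_rw [norm_mul, integral_const_mul]
  rw [norm_mul, norm_norm]
  gcongr
  rw [Real.norm_of_nonneg (integral_nonneg fun ω => by positivity)]
  have hle : ∫ ω, ‖Y r ω‖ * ‖Z ω‖ ∂P ≤ ∫ ω, (Y r ω ^ 2 + Z ω ^ 2) / 2 ∂P := by
    refine integral_mono ((hY2 r).norm.integrable_mul hZ.norm)
      (((hY2 r).integrable_sq.add hZ.integrable_sq).div_const 2) fun ω => ?_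
    have := two_mul_le_add_sq ‖Y r ω‖ ‖Z ω‖
    simp only [Real.norm_eq_abs, sq_abs] at this ⊢
    linarith
  rw [integral_div, integral_add (hY2 r).integrable_sq hZ.integrable_sq] at hle
  linarith [hYb r]

theorem memLp_integral_mul (hs : 0 ≤ s) (hk : IntervalIntegrable k volume 0 s)
    (hYm : ∀ r, Measurable (Y r)) (hYc : ∀ ω, Continuous fun r => Y r ω) {C : ℝ}
    (hY2 : ∀ r, MemLp (Y r) 2 P) (hYb : ∀ r, ∫ ω, Y r ω ^ 2 ∂P ≤ C) :
    MemLp (fun ω => ∫ r in (0 : ℝ)..s, k r * Y r ω) 2 P := by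
  have hm := measurable_integral_mul hs hk hYm hYc
  rw [memLp_two_iff_integrable_sq hm.aestronglyMeasurable]
  have hk' := (intervalIntegrable_iff_integrableOn_Ioc_of_le hs).1 hk
  have hY := stronglyMeasurable_uncurry_of_continuous_of_stronglyMeasurable hYc
    fun r => (hYm r).stronglyMeasurable
  have hmeas : AEStronglyMeasurable (fun z : ℝ × Ω => |k z.1| * Y z.1 z.2 ^ 2)
      ((volume.restrict (Ioc 0 s)).prod P) :=
    hk'.aestronglyMeasurable.norm.comp_fst.mul (hY.pow 2).aestronglyMeasurable
  have hint : Integrable (fun z : ℝ × Ω => |k z.1| * Y z.1 z.2 ^ 2)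
      ((volume.restrict (Ioc 0 s)).prod P) := by
    rw [integrable_prod_iff hmeas]
    refine ⟨Eventually.of_forall fun r => (hY2 r).integrable_sq.const_mul |k r|, ?_⟩
    refine (hk'.norm.mul_const C).mono' hmeas.norm.integral_prod_right'
      (Eventually.of_forall fun r => ?_)
    have h0 : 0 ≤ ∫ ω, Y r ω ^ 2 ∂P := integral_nonneg fun ω => sq_nonneg _
    simp only [norm_mul, Real.norm_eq_abs, abs_abs, abs_pow, sq_abs, integral_const_mul]
    rw [abs_of_nonneg h0]
    gcongr
    exact hYb r
  refine (hint.integral_prod_right.const_mul (∫ r in (0 : ℝ)..s, |k r|)).mono'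
    (hm.pow_const 2).aestronglyMeasurable (Eventually.of_forall fun ω => ?_)
  rw [Real.norm_of_nonneg (sq_nonneg _), ← intervalIntegral.integral_of_le hs]
  exact sq_integral_mul_le hs hk (hYc ω)

/-- Covariance commutes with time integration. -/
theorem covariance_integral_mul (hs : 0 ≤ s) (hk : IntervalIntegrable k volume 0 s)
    (hYm : ∀ r, Measurable (Y r)) (hYc : ∀ ω, Continuous fun r => Y r ω) {C : ℝ}
    (hY2 : ∀ r, MemLp (Y r) 2 P) (hYb : ∀ r, ∫ ω, Y r ω ^ 2 ∂P ≤ C) {Z : Ω → ℝ}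
    (hZ : MemLp Z 2 P) :
    cov[fun ω => ∫ r in (0 : ℝ)..s, k r * Y r ω, Z; P] =
      ∫ r in (0 : ℝ)..s, k r * cov[Y r, Z; P] := by
  have hW := memLp_integral_mul hs hk hYm hYc hY2 hYb
  have key : ∀ {Z : Ω → ℝ}, MemLp Z 2 P →
      IntegrableOn (fun r => k r * ∫ ω, Y r ω * Z ω ∂P) (Ioc 0 s) ∧
      ∫ ω, (∫ r in (0 : ℝ)..s, k r * Y r ω) * Z ω ∂P =
        ∫ r in Ioc 0 s, k r * ∫ ω, Y r ω * Z ω ∂P := by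
    intro Z hZ
    have hi := integrable_prod_mul_mul hs hk hYm hYc hY2 hYb hZ
    have hi' := hi.integral_prod_left
    simp only [integral_const_mul] at hi'
    refine ⟨hi', ?_⟩
    have := integral_integral_swap (f := fun r ω => k r * (Y r ω * Z ω)) hi
    simp_rw [integral_const_mul] at this
    rw [this]
    refine integral_congr_ae (Eventually.of_forall fun ω => ?_)
    simp only [intervalIntegral.integral_of_le hs, ← mul_assoc, integral_mul_const]
  have h1 := key hZ
  have h2 := key (memLp_const (1 : ℝ))
  simp only [mul_one] at h2
  rw [covariance_eq_sub hW hZ, intervalIntegral.integral_of_le hs]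
  simp_rw [fun r => covariance_eq_sub (hY2 r) hZ, Pi.mul_apply, mul_sub, ← mul_assoc]
  rw [integral_sub h1.1 (h2.1.mul_const _), integral_mul_const, h1.2, h2.2]

end

end

/-! ### Cross-covariance matrices -/

section

variable {Ω : Type*} [MeasurableSpace Ω] {P : Measure Ω} {p q n : ℕ}

theorem crossCov_transpose (X : Ω → Fin p → ℝ) (Y : Ω → Fin q → ℝ) :
    (crossCov X Y P)ᵀ = crossCov Y X P := by
  ext i j; simp [crossCov, covariance_comm]

theorem crossCov_congr {X X' : Ω → Fin p → ℝ} {Y Y' : Ω → Fin q → ℝ} (hX : X =ᵐ[P] X')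
    (hY : Y =ᵐ[P] Y') : crossCov X Y P = crossCov X' Y' P := by
  ext i j
  simp only [crossCov, Matrix.of_apply, covariance]
  have h1 : ∫ ω, X ω i ∂P = ∫ ω, X' ω i ∂P := integral_congr_ae (by
    filter_upwards [hX] with ω h; rw [h])
  have h2 : ∫ ω, Y ω j ∂P = ∫ ω, Y' ω j ∂P := integral_congr_ae (by
    filter_upwards [hY] with ω h; rw [h])
  refine integral_congr_ae ?_
  filter_upwards [hX, hY] with ω h h'
  rw [h, h', h1, h2]

theorem memLp_mulVec (M : Matrix (Fin n) (Fin p) ℝ) {X : Ω → Fin p → ℝ}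
    (hX : ∀ i, MemLp (fun ω => X ω i) 2 P) (i : Fin n) :
    MemLp (fun ω => (M *ᵥ X ω) i) 2 P :=
  memLp_finsetSum Finset.univ fun k _ => (hX k).const_mul (M i k)

variable [IsProbabilityMeasure P]

theorem crossCov_add_left {X X' : Ω → Fin p → ℝ} {Y : Ω → Fin q → ℝ}
    (hX : ∀ i, MemLp (fun ω => X ω i) 2 P) (hX' : ∀ i, MemLp (fun ω => X' ω i) 2 P)
    (hY : ∀ i, MemLp (fun ω => Y ω i) 2 P) :
    crossCov (fun ω => X ω + X' ω) Y P = crossCov X Y P + crossCov X' Y P := by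
  ext i j
  exact covariance_add_left (hX i) (hX' i) (hY j)

theorem crossCov_add_right {X : Ω → Fin p → ℝ} {Y Y' : Ω → Fin q → ℝ}
    (hX : ∀ i, MemLp (fun ω => X ω i) 2 P) (hY : ∀ i, MemLp (fun ω => Y ω i) 2 P)
    (hY' : ∀ i, MemLp (fun ω => Y' ω i) 2 P) :
    crossCov X (fun ω => Y ω + Y' ω) P = crossCov X Y P + crossCov X Y' P := by
  ext i j
  exact covariance_add_right (hX i) (hY j) (hY' j)

theorem crossCov_mulVec_left (M : Matrix (Fin n) (Fin p) ℝ) {X : Ω → Fin p → ℝ}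
    {Y : Ω → Fin q → ℝ} (hX : ∀ i, MemLp (fun ω => X ω i) 2 P)
    (hY : ∀ i, MemLp (fun ω => Y ω i) 2 P) :
    crossCov (fun ω => M *ᵥ X ω) Y P = M * crossCov X Y P := by
  ext i j
  have := covariance_fun_sum_left (X := fun k ω => M i k * X ω k)
    (fun k => (hX k).const_mul (M i k)) (hY j)
  simp only [covariance_const_mul_left] at this
  exact this

theorem crossCov_mulVec_right (M : Matrix (Fin n) (Fin q) ℝ) {X : Ω → Fin p → ℝ}
    {Y : Ω → Fin q → ℝ} (hX : ∀ i, MemLp (fun ω => X ω i) 2 P)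
    (hY : ∀ i, MemLp (fun ω => Y ω i) 2 P) :
    crossCov X (fun ω => M *ᵥ Y ω) P = crossCov X Y P * Mᵀ := by
  rw [← crossCov_transpose, crossCov_mulVec_left M hY hX, Matrix.transpose_mul, crossCov_transpose]

/-! ### Covariance of the solution of a linear stochastic equation -/

/-- Stopping an absolutely continuous function at time `v` cuts off its derivative after `v`. -/
theorem HasIntegralDerivOn.stopped {M f : ℝ → Matrix (Fin p) (Fin q) ℝ} {t v : ℝ}
    (h : HasIntegralDerivOn M f 0 t) (hv : v ∈ Icc 0 t) :
    HasIntegralDerivOn (fun r => M (min r v)) (fun r => if r ≤ v then f r else 0) 0 t := by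
  intro i j
  have ht : 0 ≤ t := hv.1.trans hv.2
  have e : (fun r => (if r ≤ v then f r else 0) i j) = (Iic v).indicator fun r => f r i j := by
    ext r; by_cases hr : r ≤ v <;> simp [hr]
  have h1 := (intervalIntegrable_iff_integrableOn_Ioc_of_le ht).1 (h i j).1
  rw [e]
  refine ⟨(intervalIntegrable_iff_integrableOn_Ioc_of_le ht).2 (h1.indicator measurableSet_Iic),
    fun s hs => ?_⟩
  have hm : min s v ∈ Icc 0 t := ⟨le_min hs.1 hv.1, (min_le_left _ _).trans hs.2⟩
  change M (min s v) i j = M (min 0 v) i j + _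
  rw [min_eq_left hv.1, (h i j).2 _ hm, intervalIntegral.integral_of_le hm.1,
    intervalIntegral.integral_of_le hs.1, integral_indicator measurableSet_Iic,
    Measure.restrict_restrict measurableSet_Iic, inter_comm, Ioc_inter_Iic]

/-- The process `Θ s J s + ∫₀ˢ Θ A J dr`, which for `Θ' = -Θ A` is the integral `∫₀ˢ Θ dJ`
written by parts. -/
noncomputable def integralByParts {Ω : Type*} {p : ℕ}
    (Θ A : ℝ → Matrix (Fin p) (Fin p) ℝ) (J : ℝ → Ω → Fin p → ℝ) (s : ℝ) (ω : Ω) :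
    Fin p → ℝ :=
  Θ s *ᵥ J s ω + fun k => ∑ i, ∫ r in (0 : ℝ)..s, (Θ r * A r) k i * J r ω i

section

variable {t : ℝ} {Θ A : ℝ → Matrix (Fin p) (Fin p) ℝ} {J : ℝ → Ω → Fin p → ℝ} {C : ℝ}

theorem memLp_integralByParts (hΘ : HasIntegralDerivOn Θ (fun s => -(Θ s * A s)) 0 t)
    (hJm : ∀ r i, Measurable fun ω => J r ω i) (hJc : ∀ ω i, Continuous fun r => J r ω i)
    (hJ2 : ∀ r i, MemLp (fun ω => J r ω i) 2 P) (hJb : ∀ r i, ∫ ω, J r ω i ^ 2 ∂P ≤ C)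
    {s : ℝ} (hs : s ∈ Icc 0 t) (k : Fin p) :
    MemLp (fun ω => integralByParts Θ A J s ω k) 2 P := by
  refine (memLp_mulVec (Θ s) (hJ2 s) k).add (memLp_finsetSum Finset.univ fun i _ => ?_)
  have hk := (((hΘ.mono le_rfl hs.1 hs.2) k i).1.neg)
  simp only [Matrix.neg_apply] at hk
  refine memLp_integral_mul hs.1 (hk.congr fun r _ => ?_) (fun r => hJm r i) (fun ω => hJc ω i)
    (fun r => hJ2 r i) (fun r => hJb r i)
  simp

/-- If the covariance of `J` with `Z` up to time `v` has density `f`, then the covariance of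
`∫₀ Θ dJ` with `Z` has density `Θ f`. -/
theorem crossCov_integralByParts (hΘ : HasIntegralDerivOn Θ (fun s => -(Θ s * A s)) 0 t)
    (hJm : ∀ r i, Measurable fun ω => J r ω i) (hJc : ∀ ω i, Continuous fun r => J r ω i)
    (hJ2 : ∀ r i, MemLp (fun ω => J r ω i) 2 P) (hJb : ∀ r i, ∫ ω, J r ω i ^ 2 ∂P ≤ C)
    {Z : Ω → Fin n → ℝ} (hZ : ∀ i, MemLp (fun ω => Z ω i) 2 P) {v : ℝ} (hv : v ∈ Icc 0 t)
    {c f Q : ℝ → Matrix (Fin p) (Fin n) ℝ} (hc : HasIntegralDerivOn c f 0 t) (hc0 : c 0 = 0)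
    (hcov : ∀ r ∈ Icc 0 t, crossCov (J r) Z P = c (min r v))
    (hQ : HasIntegralDerivOn Q (fun r => Θ r * f r) 0 t) (hQ0 : Q 0 = 0)
    {s : ℝ} (hs : s ∈ Icc 0 t) :
    crossCov (integralByParts Θ A J s) Z P = Q (min s v) := by
  have ht : 0 ≤ t := hv.1.trans hv.2
  have hΘA : ∀ k i, IntervalIntegrable (fun r => (Θ r * A r) k i) volume 0 t := fun k i =>
    (hΘ k i).1.neg.congr fun r _ => by simp
  have hΘAs : ∀ k i, IntervalIntegrable (fun r => (Θ r * A r) k i) volume 0 s := fun k i =>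
    (hΘA k i).mono_set (by
      rw [uIcc_of_le ht, uIcc_of_le hs.1]; exact Icc_subset_Icc_right hs.2)
  have hcv := hc.stopped hv
  have hint : ∀ k j, IntervalIntegrable (fun r => (Θ r * A r * c (min r v)) k j) volume 0 t :=
    intervalIntegrable_mul_of_continuousOn ht hΘA (hcv.continuousOn ht)
  -- the covariance is `Θ c + ∫ Θ A c`, with `c` stopped at `v`
  have h1 : crossCov (integralByParts Θ A J s) Z P = Θ s * c (min s v) +
      Matrix.of fun k j => ∫ r in (0 : ℝ)..s, (Θ r * A r * c (min r v)) k j := by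
    have hI : ∀ k i, MemLp (fun ω => ∫ r in (0 : ℝ)..s, (Θ r * A r) k i * J r ω i) 2 P :=
      fun k i => memLp_integral_mul hs.1 (hΘAs k i) (fun r => hJm r i) (fun ω => hJc ω i)
        (fun r => hJ2 r i) (fun r => hJb r i)
    have e := crossCov_add_left (X := fun ω => Θ s *ᵥ J s ω)
      (X' := fun ω k => ∑ i, ∫ r in (0 : ℝ)..s, (Θ r * A r) k i * J r ω i)
      (memLp_mulVec (Θ s) (hJ2 s)) (fun k => memLp_finsetSum Finset.univ fun i _ => hI k i) hZ
    refine e.trans ?_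
    rw [crossCov_mulVec_left _ (hJ2 s) hZ, hcov s hs]
    congr 1
    ext k j
    rw [crossCov, Matrix.of_apply, Matrix.of_apply,
      covariance_fun_sum_left (X := fun i ω => ∫ r in (0 : ℝ)..s, (Θ r * A r) k i * J r ω i)
        (hI k) (hZ j)]
    have e2 : ∀ i, cov[fun ω => ∫ r in (0 : ℝ)..s, (Θ r * A r) k i * J r ω i, fun ω => Z ω j; P] =
        ∫ r in (0 : ℝ)..s, (Θ r * A r) k i * c (min r v) i j := by
      intro i
      rw [covariance_integral_mul hs.1 (hΘAs k i) (fun r => hJm r i) (fun ω => hJc ω i)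
        (fun r => hJ2 r i) (fun r => hJb r i) (hZ j)]
      refine intervalIntegral.integral_congr fun r hr => ?_
      rw [uIcc_of_le hs.1] at hr
      simp only [← hcov r ⟨hr.1, hr.2.trans hs.2⟩]
      rfl
    simp only [e2]
    rw [← intervalIntegral.integral_finsetSum]
    · simp only [Matrix.mul_apply (M := Θ _ * A _)]
    · intro i _
      refine (hΘAs k i).mul_continuousOn ((hcv.continuousOn ht i j).mono ?_)
      rw [uIcc_of_le hs.1]; exact Icc_subset_Icc_right hs.2
  rw [h1]
  have h2 := (hΘ.mul hcv ht).add (hasIntegralDerivOn_integral hint 0)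
  have h3 := (hQ.stopped hv).congr (g := fun r => -(Θ r * A r) * c (min r v) +
    Θ r * (if r ≤ v then f r else 0) + Θ r * A r * c (min r v)) ht (fun _ _ => rfl) fun r _ => by
      by_cases hr : r ≤ v <;> simp [hr]
  have := h2.eq_of_eq h3 (by simp [min_eq_left hv.1, hc0, hQ0]; rfl) hs
  simpa using this

end

end

/-- Variation of constants: `Θ x = x₀ + ∫ Θ dj` if `x = x₀ + ∫ A x dr + j` and `Θ' = -Θ A`. -/
theorem mulVec_eq_add_integralByParts {Ω : Type*} {d : ℕ} {t : ℝ}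
    {Θ A : ℝ → Matrix (Fin d) (Fin d) ℝ}
    (hΘ : HasIntegralDerivOn Θ (fun s => -(Θ s * A s)) 0 t) (hΘ0 : Θ 0 = 1)
    (hA : ∀ i j, IntervalIntegrable (fun r => A r i j) volume 0 t)
    {X J : ℝ → Ω → Fin d → ℝ} {ω : Ω} (hXc : ∀ i, Continuous fun r => X r ω i)
    (hJc : ∀ i, Continuous fun r => J r ω i)
    (h : ∀ s ∈ Icc 0 t, ∀ i,
      X s ω i = X 0 ω i + (∫ r in (0 : ℝ)..s, (A r *ᵥ X r ω) i) + J s ω i)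
    {s : ℝ} (hs : s ∈ Icc 0 t) :
    Θ s *ᵥ X s ω = X 0 ω + integralByParts Θ A J s ω := by
  have ht : 0 ≤ t := hs.1.trans hs.2
  set x : ℝ → Matrix (Fin d) (Fin 1) ℝ := fun r => Matrix.of fun i _ => X r ω i
  set y : ℝ → Matrix (Fin d) (Fin 1) ℝ := fun r => Matrix.of fun i _ => J r ω i
  have hJ0 : y 0 = 0 := by
    ext i j
    have := h 0 ⟨le_rfl, ht⟩ i
    simp only [intervalIntegral.integral_same, add_zero, left_eq_add] at this
    simpa [y] using this
  have hAx : ∀ i j, IntervalIntegrable (fun r => (A r * x r) i j) volume 0 t :=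
    intervalIntegrable_mul_of_continuousOn ht hA fun i _ => (hXc i).continuousOn
  have hΘAy : ∀ i j, IntervalIntegrable (fun r => (Θ r * A r * y r) i j) volume 0 t :=
    intervalIntegrable_mul_of_continuousOn ht
      (fun i j => (hΘ i j).1.neg.congr fun r _ => by simp) fun i _ => (hJc i).continuousOn
  have hη : HasIntegralDerivOn (fun r => x r - y r) (fun r => A r * x r) 0 t := by
    refine (hasIntegralDerivOn_integral hAx (x 0)).congr ht (fun r hr => ?_) fun _ _ => rfl
    ext i j
    have h1 := h r hr i
    have h2 : (fun r => (A r * x r) i j) = fun r => (A r *ᵥ X r ω) i := rfl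
    simp only [Matrix.add_apply, Matrix.sub_apply, Matrix.of_apply, h2]
    simp only [x, y, Matrix.of_apply]
    linarith
  have h1 := (hΘ.mul hη ht).congr (g := fun r => Θ r * A r * y r) ht (fun _ _ => rfl)
    fun r _ => by rw [Matrix.mul_sub, Matrix.neg_mul, Matrix.neg_mul, ← Matrix.mul_assoc]; abel
  have h2 := hasIntegralDerivOn_integral hΘAy (x 0)
  have h3 := h1.eq_of_eq h2 (by simp [hΘ0, hJ0]; rfl) hs
  ext k
  have h4 : (∫ r in (0 : ℝ)..s, (Θ r * A r * y r) k 0) =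
      ∑ i, ∫ r in (0 : ℝ)..s, (Θ r * A r) k i * J r ω i := by
    rw [← intervalIntegral.integral_finsetSum]
    · simp only [Matrix.mul_apply (M := Θ _ * A _), y, Matrix.of_apply]
    · intro i _
      refine IntervalIntegrable.mul_continuousOn ?_ (hJc i).continuousOn
      have := ((hΘ.mono le_rfl hs.1 hs.2) k i).1.neg
      exact this.congr fun r _ => by simp
  have h5 := congrFun (congrFun h3 k) 0
  have h6 : (Θ s * (x s - y s)) k 0 = (Θ s *ᵥ X s ω) k - (Θ s *ᵥ J s ω) k := by
    rw [Matrix.mul_sub]; rfl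
  rw [h6, Matrix.add_apply, Matrix.of_apply, h4] at h5
  have h7 : x 0 k 0 = X 0 ω k := rfl
  rw [h7] at h5
  simp only [integralByParts, Pi.add_apply]
  linarith

section

variable {Ω : Type*} [MeasurableSpace Ω] {P : Measure Ω} {d m : ℕ}

/-- The martingale part of a solution: for a solution `ξ` there are a modification `X` with
continuous measurable paths, and a process `J` with continuous measurable paths such that
`X s = X 0 + ∫₀ˢ A X dr + J s` on `[0, t]` and `J s` is the Wiener integral `∫₀ˢ b dB`. The
process `J` is frozen outside `[0, t]`, so that bounds on `[0, t]` hold for all times. -/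
theorem IsLinearSDESolution.exists_decomposition {B : Fin m → ℝ≥0 → Ω → ℝ}
    {A : ℝ → Matrix (Fin d) (Fin d) ℝ} {b : ℝ → Matrix (Fin d) (Fin m) ℝ} {t : ℝ}
    {ξ : ℝ → Ω → Fin d → ℝ} (hξ : IsLinearSDESolution B P A b t ξ) (ht : 0 ≤ t)
    (hA : ∀ i j, IntervalIntegrable (fun r => A r i j) volume 0 t) :
    ∃ X J : ℝ → Ω → Fin d → ℝ, (∀ s ∈ Icc 0 t, X s =ᵐ[P] ξ s) ∧
      (∀ ω i, Continuous fun r => X r ω i) ∧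
      (∀ r i, Measurable fun ω => J r ω i) ∧ (∀ ω i, Continuous fun r => J r ω i) ∧
      (∀ r, ∃ r' ∈ Icc 0 t, J r = J r') ∧
      (∀ s ∈ Icc 0 t, IsWienerIntegral B P b s (J s)) ∧
      ∀ ω, ∀ s ∈ Icc 0 t, ∀ i,
        X s ω i = X 0 ω i + (∫ r in (0 : ℝ)..s, (A r *ᵥ X r ω) i) + J s ω i := by
  obtain ⟨X, hXm, hXc, hXξ⟩ := exists_continuous_modification ht hξ.aemeasurable hξ.continuousOn
  have hXmi : ∀ r i, Measurable fun ω => X r ω i := fun r i => measurable_pi_iff.1 (hXm r) i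
  have hXci : ∀ ω i, Continuous fun r => X r ω i := fun ω i => continuous_pi_iff.1 (hXc ω) i
  have hAs : ∀ s ∈ Icc 0 t, ∀ i j, IntervalIntegrable (fun r => A r i j) volume 0 s :=
    fun s hs i j => (hA i j).mono_set (by
      rw [uIcc_of_le ht, uIcc_of_le hs.1]; exact Icc_subset_Icc_right hs.2)
  have hAX : ∀ ω, ∀ s ∈ Icc 0 t, ∀ i k,
      IntervalIntegrable (fun r => A r i k * X r ω k) volume 0 s := fun ω s hs i k =>
    (hAs s hs i k).mul_continuousOn (hXci ω k).continuousOn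
  have hAXv : ∀ ω, ∀ s ∈ Icc 0 t, ∀ i,
      IntervalIntegrable (fun r => (A r *ᵥ X r ω) i) volume 0 s := by
    intro ω s hs i
    have := IntervalIntegrable.sum Finset.univ fun k (_ : k ∈ Finset.univ) => hAX ω s hs i k
    have e : (fun r => (A r *ᵥ X r ω) i) = fun r => ∑ k, A r i k * X r ω k := by
      ext r; simp [Matrix.mulVec, dotProduct]
    rw [e]
    simpa only [Finset.sum_fn] using this
  set π : ℝ → ℝ := fun s => projIcc 0 t ht s with hπ
  have hπc : Continuous π := continuous_subtype_val.comp continuous_projIcc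
  have hπm : ∀ s, π s ∈ Icc 0 t := fun s => (projIcc 0 t ht s).2
  have hπe : ∀ s ∈ Icc 0 t, π s = s := fun s hs => by simp [hπ, projIcc_of_mem ht hs]
  set J : ℝ → Ω → Fin d → ℝ := fun s ω i =>
    X (π s) ω i - X 0 ω i - ∫ r in (0 : ℝ)..π s, (A r *ᵥ X r ω) i with hJ
  refine ⟨X, J, fun s hs => ?_, hXci, fun s i => ?_, fun ω i => ?_, fun r => ⟨π r, hπm r, ?_⟩,
    fun s hs => ?_, fun ω s hs i => ?_⟩
  · filter_upwards [hXξ] with ω h using h s hs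
  · refine ((hXmi _ i).sub (hXmi 0 i)).sub ?_
    have e : (fun ω => ∫ r in (0 : ℝ)..π s, (A r *ᵥ X r ω) i) =
        fun ω => ∑ k, ∫ r in (0 : ℝ)..π s, A r i k * X r ω k := by
      ext ω
      rw [← intervalIntegral.integral_finsetSum fun k _ => hAX ω _ (hπm s) i k]
      rfl
    rw [e]
    exact Finset.measurable_fun_sum _ fun k _ =>
      measurable_integral_mul (hπm s).1 (hAs _ (hπm s) i k) (fun r => hXmi r k) fun ω => hXci ω k
  · have h := intervalIntegral.continuousOn_primitive_interval'
      (hAXv ω t ⟨ht, le_rfl⟩ i) left_mem_uIcc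
    rw [uIcc_of_le ht] at h
    exact (((hXci ω i).comp hπc).sub continuous_const).sub (h.comp_continuous hπc hπm)
  · ext ω i
    simp only [hJ, hπe _ (hπm r)]
  · refine (hξ.eqn s hs).congr ?_
    filter_upwards [hXξ] with ω h
    ext i
    simp only [hJ, hπe s hs, Pi.sub_apply]
    rw [h s hs, h 0 ⟨le_rfl, ht⟩]
    congr 1
    have e : ∫ r in (0 : ℝ)..s, A r *ᵥ ξ r ω = ∫ r in (0 : ℝ)..s, A r *ᵥ X r ω := by
      refine intervalIntegral.integral_congr fun r hr => ?_
      rw [uIcc_of_le hs.1] at hr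
      simp only [h r ⟨hr.1, hr.2.trans hs.2⟩]
    rw [e, intervalIntegral.integral_of_le hs.1, intervalIntegral.integral_of_le hs.1]
    exact eval_integral (fun i =>
      (intervalIntegrable_iff_integrableOn_Ioc_of_le hs.1).1 (hAXv ω s hs i)) i
  · simp only [hJ, hπe s hs]; ring

/-- The covariance function of the solution of a linear stochastic equation: in the coordinates
`Θ s ξ s = ξ 0 + ∫₀ˢ Θ b dB` the process has uncorrelated increments. -/
theorem IsLinearSDESolution.crossCov_eq [IsProbabilityMeasure P] {B : Fin m → ℝ≥0 → Ω → ℝ}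
    (hB : IsBrownianVec B P)
    {A : ℝ → Matrix (Fin d) (Fin d) ℝ} {b : ℝ → Matrix (Fin d) (Fin m) ℝ} {t : ℝ}
    {ξ : ℝ → Ω → Fin d → ℝ} (hξ : IsLinearSDESolution B P A b t ξ) (ht : 0 ≤ t)
    (hA : ∀ i j, IntervalIntegrable (fun r => A r i j) volume 0 t)
    (hb : ∀ i j, MemLp (fun r => b r i j) 2 (volume.restrict (Icc 0 t)))
    (hbb : ∀ i j, IntervalIntegrable (fun r => (b r * (b r)ᵀ) i j) volume 0 t)
    (hξ0 : ∀ i, MemLp (fun ω => ξ 0 ω i) 2 P)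
    (hind : IndepFun (ξ 0) (fun ω (j : Fin m) (r : ℝ≥0) => B j r ω) P)
    {Ψ Θ G : ℝ → Matrix (Fin d) (Fin d) ℝ} (hΘ0 : Θ 0 = 1)
    (hΘ : HasIntegralDerivOn Θ (fun s => -(Θ s * A s)) 0 t)
    (hΨΘ : ∀ s ∈ Icc 0 t, Ψ s * Θ s = 1)
    (hG : HasIntegralDerivOn G (fun s => Θ s * (b s * (b s)ᵀ) * (Θ s)ᵀ) 0 t)
    (hG0 : G 0 = crossCov (ξ 0) (ξ 0) P) :
    (∀ s ∈ Icc 0 t, ∀ i, MemLp (fun ω => ξ s ω i) 2 P) ∧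
    ∀ s ∈ Icc 0 t, ∀ u ∈ Icc 0 t,
      crossCov (ξ s) (ξ u) P = Ψ s * G (min s u) * (Ψ u)ᵀ := by
  obtain ⟨X, J, hXξ, hXc, hJm, hJc, hJclamp, hJw, hXJ⟩ := hξ.exists_decomposition ht hA
  have h0t : (0 : ℝ) ∈ Icc 0 t := ⟨le_rfl, ht⟩
  have hX0 : ∀ i, MemLp (fun ω => X 0 ω i) 2 P := fun i =>
    (memLp_congr_ae (by filter_upwards [hXξ 0 h0t] with ω h; rw [h])).2 (hξ0 i)
  have hJ2' : ∀ r ∈ Icc 0 t, ∀ i, MemLp (fun ω => J r ω i) 2 P := fun r hr i =>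
    (hJw r hr).memLp hB i (hJm r i).aestronglyMeasurable
  have hJ2 : ∀ r i, MemLp (fun ω => J r ω i) 2 P := by
    intro r i
    obtain ⟨r', hr', e⟩ := hJclamp r
    rw [e]; exact hJ2' r' hr' i
  have hβ := hasIntegralDerivOn_integral hbb 0
  set β : ℝ → Matrix (Fin d) (Fin d) ℝ := fun s =>
    0 + Matrix.of fun i j => ∫ r in (0 : ℝ)..s, (b r * (b r)ᵀ) i j with hβdef
  have hβ0 : β 0 = 0 := by simp [hβdef]; rfl
  have hJJ : ∀ r ∈ Icc 0 t, ∀ v ∈ Icc 0 t, crossCov (J r) (J v) P = β (min r v) := by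
    intro r hr v hv
    ext i j
    have := (hJw r hr).covariance_eq hB hr.1 hv.1 (fun i j => (hb i j).mono_measure
      (Measure.restrict_mono (Icc_subset_Icc_right ((min_le_left _ _).trans hr.2)) le_rfl))
      (hJw v hv) i j (hJ2 r i) (hJ2 v j)
    rw [crossCov, Matrix.of_apply, this]
    simp [hβdef]
  -- the second moments of `J` are the diagonal entries of `∫ b bᵀ`, which are bounded on `[0, t]`
  obtain ⟨C, hC⟩ : ∃ C, ∀ r i, ∫ ω, J r ω i ^ 2 ∂P ≤ C := by
    have hbound : ∀ i, ∃ C, ∀ r ∈ Icc 0 t, ‖β r i i‖ ≤ C := fun i =>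
      isCompact_Icc.exists_bound_of_continuousOn (hβ.continuousOn ht i i)
    choose C hC using hbound
    refine ⟨∑ i, |C i|, fun r i => ?_⟩
    obtain ⟨r', hr', e⟩ := hJclamp r
    have h1 := covariance_eq_sub (hJ2 r' i) (hJ2 r' i)
    have h2 : cov[fun ω => J r' ω i, fun ω => J r' ω i; P] = β r' i i := by
      have := congrFun (congrFun (hJJ r' hr' r' hr') i) i
      rwa [min_self] at this
    rw [h2, (hJw r' hr').integral_eq_zero hB i (hJ2 r' i), mul_zero, sub_zero] at h1
    have h3 : ∫ ω, J r ω i ^ 2 ∂P = β r' i i := by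
      rw [h1, e]; simp only [Pi.mul_apply, sq]
    rw [h3]
    refine ((le_abs_self _).trans (hC i r' hr')).trans ((le_abs_self _).trans ?_)
    exact Finset.single_le_sum (f := fun i => |C i|) (fun _ _ => abs_nonneg _) (Finset.mem_univ i)
  have hJ0 : ∀ r ∈ Icc 0 t, crossCov (J r) (X 0) P = 0 := by
    intro r hr
    rw [crossCov_congr (ae_eq_refl (J r)) (hXξ 0 h0t)]
    ext i j
    exact (hJw r hr).covariance_eq_zero hB i (hJ2 r i) (hξ0 j)
      (hind.comp (measurable_pi_apply j) measurable_id)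
  set W := integralByParts Θ A J with hW
  have hW2 : ∀ s ∈ Icc 0 t, ∀ i, MemLp (fun ω => W s ω i) 2 P := fun s hs i =>
    memLp_integralByParts hΘ hJm hJc hJ2 hC hs i
  -- `W` is uncorrelated with the initial value
  have hWX : ∀ s ∈ Icc 0 t, crossCov (W s) (X 0) P = 0 := fun s hs =>
    crossCov_integralByParts (c := fun _ => 0) (f := fun _ => 0) (Q := fun _ => 0)
      hΘ hJm hJc hJ2 hC hX0 ⟨ht, le_rfl⟩ (hasIntegralDerivOn_const 0) rfl hJ0
      ((hasIntegralDerivOn_const 0).congr ht (fun _ _ => rfl) fun _ _ => by simp) rfl hs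
  have hQint : ∀ i j, IntervalIntegrable (fun r => (Θ r * (b r * (b r)ᵀ)) i j) volume 0 t :=
    intervalIntegrable_continuousOn_mul ht (hΘ.continuousOn ht) hbb
  have hQ := hasIntegralDerivOn_integral hQint 0
  set Q : ℝ → Matrix (Fin d) (Fin d) ℝ := fun s =>
    0 + Matrix.of fun i j => ∫ r in (0 : ℝ)..s, (Θ r * (b r * (b r)ᵀ)) i j with hQdef
  have hQ0 : Q 0 = 0 := by simp [hQdef]; rfl
  have hWJ : ∀ s ∈ Icc 0 t, ∀ u ∈ Icc 0 t, crossCov (W s) (J u) P = Q (min s u) :=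
    fun s hs u hu => crossCov_integralByParts hΘ hJm hJc hJ2 hC (hJ2 u) hu hβ hβ0
      (fun r hr => hJJ r hr u hu) hQ hQ0 hs
  have hWW : ∀ s ∈ Icc 0 t, ∀ u ∈ Icc 0 t, crossCov (W s) (W u) P = G (min s u) - G 0 := by
    intro s hs u hu
    refine crossCov_integralByParts (Q := fun r => G r - G 0) hΘ hJm hJc hJ2 hC (hW2 u hu) hu
      hQ.transpose (by rw [hQ0, Matrix.transpose_zero]) (fun r hr => ?_)
      ((hG.add (hasIntegralDerivOn_const (-(G 0)))).congr ht
        (fun r _ => (sub_eq_add_neg _ _).symm) fun r _ => ?_) (sub_self _) hs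
    · rw [← crossCov_transpose, hWJ u hu r hr, min_comm]
    · simp [Matrix.mul_assoc]
  -- `X = Ψ (X 0 + W)` in terms of the fundamental solution `Ψ = Θ⁻¹`
  have hU2 : ∀ s ∈ Icc 0 t, ∀ i, MemLp (fun ω => (X 0 ω + W s ω) i) 2 P := fun s hs i =>
    (hX0 i).add (hW2 s hs i)
  have hXU : ∀ s ∈ Icc 0 t, ξ s =ᵐ[P] fun ω => Ψ s *ᵥ (X 0 ω + W s ω) := by
    intro s hs
    filter_upwards [hXξ s hs] with ω h
    rw [← h, hW, ← mulVec_eq_add_integralByParts hΘ hΘ0 hA (hXc ω) (hJc ω) (hXJ ω) hs,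
      Matrix.mulVec_mulVec, hΨΘ s hs, Matrix.one_mulVec]
  refine ⟨fun s hs i => ?_, fun s hs u hu => ?_⟩
  · exact (memLp_congr_ae (by filter_upwards [hXU s hs] with ω h; rw [h])).2
      (memLp_mulVec (Ψ s) (hU2 s hs) i)
  · rw [crossCov_congr (hXU s hs) (hXU u hu),
      crossCov_mulVec_left _ (hU2 s hs) (memLp_mulVec (Ψ u) (hU2 u hu)),
      crossCov_mulVec_right _ (hU2 s hs) (hU2 u hu),
      crossCov_add_left hX0 (hW2 s hs) (hU2 u hu), crossCov_add_right hX0 hX0 (hW2 u hu),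
      crossCov_add_right (hW2 s hs) hX0 (hW2 u hu), hWX s hs, hWW s hs u hu,
      ← crossCov_transpose (W u) (X 0), hWX u hu,
      crossCov_congr (hXξ 0 h0t) (hXξ 0 h0t), ← hG0, ← mul_assoc]
    simp

end

/-! ### The cross-covariance of the smoothing family -/

/-- The fundamental solution and its inverse for a coefficient that is integrable on a bounded
interval only. -/
theorem exists_fundamental_solution_inverse_Icc {d : ℕ} {A : ℝ → Matrix (Fin d) (Fin d) ℝ} {t : ℝ}
    (ht : 0 ≤ t) (hA : ∀ i j, IntervalIntegrable (fun r => A r i j) volume 0 t) :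
    ∃ Ψ Θ : ℝ → Matrix (Fin d) (Fin d) ℝ, Ψ 0 = 1 ∧ Θ 0 = 1 ∧
      HasIntegralDerivOn Ψ (fun s => A s * Ψ s) 0 t ∧
      HasIntegralDerivOn Θ (fun s => -(Θ s * A s)) 0 t ∧
      (∀ s ∈ Icc 0 t, Θ s * Ψ s = 1) ∧ ∀ s ∈ Icc 0 t, Ψ s * Θ s = 1 := by
  set A' : ℝ → Matrix (Fin d) (Fin d) ℝ := (Icc 0 t).indicator A
  have hA' : ∀ i j T, 0 ≤ T → IntervalIntegrable (fun r => A' r i j) volume 0 T := by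
    intro i j T _
    have e : (fun r => A' r i j) = (Icc 0 t).indicator fun r => A r i j := by
      ext r; by_cases hr : r ∈ Icc 0 t <;> simp [A', hr]
    rw [e]
    exact (((intervalIntegrable_iff_integrableOn_Icc_of_le ht).1 (hA i j)).integrable_indicator
      measurableSet_Icc).intervalIntegrable
  have hAA' : ∀ s ∈ Icc 0 t, A' s = A s := fun s hs => indicator_of_mem hs A
  obtain ⟨Ψ, Θ, hΨ0, hΘ0, hΨ, hΘ, h1, h2⟩ := exists_fundamental_solution_inverse A' hA'
  exact ⟨Ψ, Θ, hΨ0, hΘ0,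
    (hΨ t ht).congr ht (fun _ _ => rfl) fun s hs => by rw [hAA' s hs],
    (hΘ t ht).congr ht (fun _ _ => rfl) fun s hs => by rw [hAA' s hs],
    fun s hs => h1 s hs.1, fun s hs => h2 s hs.1⟩

section

variable {Ω : Type*} [MeasurableSpace Ω] {P : Measure Ω} [IsProbabilityMeasure P]
  {d₁ d₂ m₁ m₂ : ℕ}
  {a : ℝ → Matrix (Fin d₁) (Fin d₁) ℝ} {b : ℝ → Matrix (Fin d₁) (Fin m₁) ℝ}
  {c : ℝ → Matrix (Fin d₂) (Fin d₁) ℝ} {σ : ℝ → Matrix (Fin d₂) (Fin m₂) ℝ}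
  {X₀ : Ω → Fin d₁ → ℝ} {φ : ℝ → ℝ → Matrix (Fin d₁) (Fin d₁) ℝ}
  {γ : ℝ → Matrix (Fin d₁) (Fin d₁) ℝ} {B : Fin m₁ → ℝ≥0 → Ω → ℝ} {ξ : ℝ → ℝ → Ω → Fin d₁ → ℝ}

/-- For `0 ≤ s ≤ t`, `ξ_{s;t}` is square integrable and `Cov(ξ_{t;t}, ξ_{s;t}) = Φ t Λ s γ s`, where
`Φ` is the fundamental solution of the filter dynamics, with inverse `Λ`. The functions `Φ` and `Λ`
are the same for all final times `t`, unlike the drift of the smoothing equation. -/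
theorem IsSmoothingFamily.memLp_and_crossCov_eq (hξ : IsSmoothingFamily B P a b φ X₀ ξ)
    (hcoef : Admissible a b c σ) (hφ : IsBackwardRiccati a b c σ φ)
    (hγ : IsForwardRiccati a b c σ (crossCov X₀ X₀ P) γ) (hB : IsBrownianVec B P)
    {Φ Λ : ℝ → Matrix (Fin d₁) (Fin d₁) ℝ} (hΛ0 : Λ 0 = 1)
    (hΛ : ∀ T, 0 ≤ T → HasIntegralDerivOn Λ (fun s => -(Λ s * (a s - γ s * obs c σ s))) 0 T)
    (hΦΛ : ∀ s, 0 ≤ s → Φ s * Λ s = 1) {t : ℝ} (ht : 0 ≤ t) :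
    (∀ s ∈ Icc 0 t, MemLp (ξ t s) 2 P) ∧
    ∀ s ∈ Icc 0 t, crossCov (ξ t t) (ξ t s) P = Φ t * Λ s * γ s := by
  have hA := hφ.intervalIntegrable_drift hcoef ht
  have hbb := hcoef.intervalIntegrable_bb ht
  obtain ⟨Ψ, Θ, hΨ0, hΘ0, hΨ, hΘ, hΘΨ, hΨΘ⟩ := exists_fundamental_solution_inverse_Icc ht hA
  have hG := hasIntegralDerivOn_integral (intervalIntegrable_mul_of_continuousOn ht
    (intervalIntegrable_continuousOn_mul ht (hΘ.continuousOn ht) hbb)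
    (fun i j => hΘ.continuousOn ht j i) (M := fun r => (Θ r)ᵀ)) (crossCov (ξ t 0) (ξ t 0) P)
  set G : ℝ → Matrix (Fin d₁) (Fin d₁) ℝ := fun s => crossCov (ξ t 0) (ξ t 0) P +
    Matrix.of fun i j => ∫ r in (0 : ℝ)..s, (Θ r * (b r * (b r)ᵀ) * (Θ r)ᵀ) i j
  have hG0 : G 0 = crossCov (ξ t 0) (ξ t 0) P := by
    ext i j; simp [G]
  obtain ⟨h1, h2⟩ := (hξ.sde t ht).crossCov_eq hB ht hA (hcoef.memLp_b ht) hbb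
    (fun i => (hξ.gaussian t ht).memLp_two.eval i) (hξ.indep t ht) hΘ0 hΘ hΨΘ hG hG0
  refine ⟨fun s hs => MemLp.of_eval (h1 s hs), fun s hs => ?_⟩
  rw [h2 t ⟨ht, le_rfl⟩ s hs, min_eq_right hs.2]
  exact fundamental_solution_mul_eq hφ hγ ht hΨ0 hΘ0 hΛ0 hΨ hΘ (hΛ t ht) hΘΨ
    (fun r hr => hΦΛ r hr.1) hG (hG0.trans (hξ.cov_zero t ht)) hs

end

end LinearFilter

theorem mainTheorem8 {Ω : Type*} [MeasurableSpace Ω] (P : Measure Ω) [IsProbabilityMeasure P]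
    {d₁ d₂ m₁ m₂ : ℕ}
    (a : ℝ → Matrix (Fin d₁) (Fin d₁) ℝ) (b : ℝ → Matrix (Fin d₁) (Fin m₁) ℝ)
    (c : ℝ → Matrix (Fin d₂) (Fin d₁) ℝ) (σ : ℝ → Matrix (Fin d₂) (Fin m₂) ℝ)
    (hcoef : LinearFilter.Admissible a b c σ)
    (X₀ : Ω → Fin d₁ → ℝ) (hX₀ : HasGaussianLaw X₀ P)
    (φ : ℝ → ℝ → Matrix (Fin d₁) (Fin d₁) ℝ)
    (hφ : LinearFilter.IsBackwardRiccati a b c σ φ)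
    (γ : ℝ → Matrix (Fin d₁) (Fin d₁) ℝ)
    (hγ : LinearFilter.IsForwardRiccati a b c σ (LinearFilter.crossCov X₀ X₀ P) γ)
    (B : Fin m₁ → ℝ≥0 → Ω → ℝ) (hB : LinearFilter.IsBrownianVec B P)
    (ξ : ℝ → ℝ → Ω → Fin d₁ → ℝ)
    (hξ : LinearFilter.IsSmoothingFamily B P a b φ X₀ ξ) :
    (∀ t, 0 ≤ t → ∀ s ∈ Icc 0 t, MemLp (ξ t s) 2 P) ∧
    (∀ s, 0 ≤ s → ∀ T, s ≤ T →
      LinearFilter.HasIntegralDerivOn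
        (fun t => LinearFilter.crossCov (ξ t t) (ξ t s) P)
        (fun t => (a t - γ t * LinearFilter.obs c σ t) *
          LinearFilter.crossCov (ξ t t) (ξ t s) P) s T) ∧
    (∃ Φ, LinearFilter.IsTransitionMatrix (fun t => a t - γ t * LinearFilter.obs c σ t) Φ) ∧
    (∀ Φ, LinearFilter.IsTransitionMatrix (fun t => a t - γ t * LinearFilter.obs c σ t) Φ →
      ∀ s, 0 ≤ s → ∀ t, s ≤ t →
        LinearFilter.crossCov (ξ t t) (ξ t s) P = Φ t s * γ s) := by
  obtain ⟨Φ, Λ, hΦ0, hΛ0, hΦ, hΛ, hΛΦ, hΦΛ⟩ :=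
    LinearFilter.exists_fundamental_solution_inverse
      (fun t => a t - γ t * LinearFilter.obs c σ t)
      fun i j T hT => hγ.intervalIntegrable_drift hφ hcoef hT i j
  have key := fun t (ht : 0 ≤ t) => hξ.memLp_and_crossCov_eq hcoef hφ hγ hB hΛ0 hΛ hΦΛ ht
  refine ⟨fun t ht => (key t ht).1, fun s hs T hsT => ?_, ⟨fun t s => Φ t * Λ s, ?_⟩, ?_⟩
  · have h := ((hΦ T (hs.trans hsT)).mono hs hsT le_rfl).mul_const hsT (Λ s * γ s)
    have e : ∀ t ∈ Icc s T,
        Φ t * (Λ s * γ s) = LinearFilter.crossCov (ξ t t) (ξ t s) P := fun t ht => by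
      rw [(key t (hs.trans ht.1)).2 s ⟨hs, ht.1⟩, mul_assoc]
    exact h.congr hsT e fun t ht => by rw [mul_assoc, e t ht]
  · exact ⟨hΦΛ, fun s hs T hsT => (((hΦ T (hs.trans hsT)).mono hs hsT le_rfl).mul_const hsT
      (Λ s)).congr hsT (fun _ _ => rfl) fun t _ => by rw [mul_assoc]⟩
  · intro Φ' hΦ' s hs t hst
    rw [(key t (hs.trans hst)).2 s ⟨hs, hst⟩]
    congr 1
    -- `Λ t Φ' t s` does not depend on `t`
    have h := (((hΛ t (hs.trans hst)).mono hs hst le_rfl).mul (hΦ'.eqn s hs t hst) hst).congr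
      (g := fun _ => 0) hst (fun _ _ => rfl) fun r _ => by simp [mul_assoc]
    have h1 := h.eq_of_eq (LinearFilter.hasIntegralDerivOn_const (Λ s))
      (by rw [hΦ'.initial s hs, mul_one]) ⟨hst, le_rfl⟩
    calc Φ t * Λ s = Φ t * (Λ t * Φ' t s) := by rw [h1]
      _ = Φ' t s := by rw [← mul_assoc, hΦΛ t (hs.trans hst), one_mul]
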